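/- Let $n\ge 1$ and let $M$ be a compact oriented smooth $n$-dimensional Riemannian manifold, possibly with boundary, with volume form $\mathrm{vol}=*1$, where $*$ is the Hodge star ($\beta\wedge *\gamma=\langle\beta,\gamma\rangle\,\mathrm{vol}$). Write $\Omega^k(M)$ for the smooth $k$-forms, and pair $\alpha\in\Omega^1(M)$ with $\omega\in\Omega^{n-1}(M)$ by $\langle\alpha,\omega\rangle=\int_M\alpha\wedge\omega$ and $f\in\Omega^0(M)$ with $\mu\in\Omega^n(M)$ by $\langle f,\mu\rangle=\int_M f\wedge\mu$. The variational derivative of a functional $F$ on $\Omega^k(M)$ at $\eta$ is the unique smooth $(n-k)$-form $\delta_\eta F$ whose pairing with every $\delta\eta\in\Omega^k(M)$ is $\frac{d}{d\epsilon}\big|_{\epsilon=0}F(\eta+\epsilon\,\delta\eta)$. For $\omega\in\Omega^{n-1}(M)$ and $\mu\in\Omega^n(M)$ let $$L_k(\omega,\mu)=\int_M\tfrac12(*\mu)\,\omega\wedge*\omega .$$ Fix $\mu\in\Omega^n(M)$ such that the function $*\mu$ (the mass density) vanishes nowhere. Then: 1. For every $\omega\in\Omega^{n-1}(M)$ the momentum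 conjugate to $\omega$, i.e. the variational derivative of $L_k(\cdot,\mu)$ at $\omega$, exists and equals $\alpha=(-1)^{n-1}(*\mu)*\omega\in\Omega^1(M)$. 2. The partial Legendre transform of $L_k$ is $$H_k(\alpha,\mu)=\int_M\frac{1}{2(*\mu)}\,\alpha\wedge*\alpha ,\qquad \alpha\in\Omega^1(M);$$ that is, every $\alpha\in\Omega^1(M)$ is the momentum conjugate to exactly one $\omega\in\Omega^{n-1}(M)$, and for this $\omega$ one has $H_k(\alpha,\mu)=\langle\alpha,\omega\rangle-L_k(\omega,\mu)$. 3. For every $\alpha\in\Omega^1(M)$ the variational derivatives of $H_k$ at $(\alpha,\mu)$ exist and are $$\delta_\alpha H_k=\frac{*\alpha}{*\mu}\in\Omega^{n-1}(M),\qquad \delta_\mu H_k=-\frac{1}{2(*\mu)^2}\,\iota_{\hat\alpha}\alpha\in\Omega^0(M),$$ where $\hat\alpha$ is the vector field metrically dual to $\alpha$ and $\iota$ is the interior product. -/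

import Mathlib

open Set MeasureTheory Bundle Manifold
open scoped ContDiff

noncomputable section

namespace FluidKinetic

/-! ### Exterior algebra of an oriented inner product space -/

section Linear

variable {k l n : ℕ}

/-- The wedge product `a ∧ b` of alternating forms: the signed sum over `(k, l)`-shuffles of
`a ⊗ b`. The degree of the result is any `n` with `k + l = n`. -/
def wedge {V : Type*} [AddCommGroup V] [Module ℝ V] (h : k + l = n)
    (a : V [⋀^Fin k]→ₗ[ℝ] ℝ) (b : V [⋀^Fin l]→ₗ[ℝ] ℝ) :
    V [⋀^Fin n]→ₗ[ℝ] ℝ :=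
  ((LinearMap.mul' ℝ ℝ).compAlternatingMap (a.domCoprod b)).domDomCongr
    (finSumFinEquiv.trans (finCongr h))

/-- The concatenation `(u₁, …, u_k, w₁, …, w_l)` of two tuples of vectors. -/
def concat {V : Type*} (h : k + l = n) (u : Fin k → V) (w : Fin l → V) : Fin n → V :=
  fun i => Sum.elim u w (finSumFinEquiv.symm (Fin.cast h.symm i))

theorem concat_update {V : Type*} [DecidableEq (Fin l)] (h : k + l = n) (u : Fin k → V)
    (w : Fin l → V) (i : Fin l) (z : V) :
    concat h u (Function.update w i z) =
      Function.update (concat h u w) (Fin.cast h (finSumFinEquiv (Sum.inr i))) z := by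
  subst h
  funext j
  obtain ⟨j, rfl⟩ := finSumFinEquiv.surjective j
  rcases j with j | j
  · have : (finSumFinEquiv (Sum.inl j) : Fin (k + l)) ≠ finSumFinEquiv (Sum.inr i) := by
      simp [-finSumFinEquiv_apply_left, -finSumFinEquiv_apply_right]
    simp only [concat, Fin.cast_refl, id_eq, Equiv.symm_apply_apply, Function.update_of_ne this,
      Sum.elim_inl]
  · by_cases hj : j = i
    · subst hj
      simp only [concat, Fin.cast_refl, id_eq, Equiv.symm_apply_apply, Function.update_self,
        Sum.elim_inr]
    · have : (finSumFinEquiv (Sum.inr j) : Fin (k + l)) ≠ finSumFinEquiv (Sum.inr i) := by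
        simpa [-finSumFinEquiv_apply_right] using hj
      simp only [concat, Fin.cast_refl, id_eq, Equiv.symm_apply_apply, Function.update_of_ne this,
        Sum.elim_inr, Function.update_of_ne hj]

/-- Insertion of the vectors `u` in the first `k` slots of `η`: the form
`w ↦ η (u₁, …, u_k, w₁, …, w_l)`. -/
def insertLeft {V : Type*} [AddCommGroup V] [Module ℝ V] (h : k + l = n)
    (η : V [⋀^Fin n]→ₗ[ℝ] ℝ) (u : Fin k → V) :
    V [⋀^Fin l]→ₗ[ℝ] ℝ where
  toFun w := η (concat h u w)
  map_update_add' w i x y := by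
    simp only [concat_update, η.map_update_add]
  map_update_smul' w i c x := by
    simp only [concat_update, η.map_update_smul]
  map_eq_zero_of_eq' w i j hw hij := by
    subst h
    refine η.map_eq_zero_of_eq _ (i := finSumFinEquiv (Sum.inr i))
      (j := finSumFinEquiv (Sum.inr j)) ?_ ?_
    · simpa only [concat, Fin.cast_refl, id_eq, Equiv.symm_apply_apply, Sum.elim_inr] using hw
    · simpa [-finSumFinEquiv_apply_right] using hij

variable {V : Type*} [NormedAddCommGroup V] [InnerProductSpace ℝ V] [FiniteDimensional ℝ V]

/-- The Hodge star of a `k`-form, in an orthonormal basis `e`: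
`(*b)(w) = (1 / k!) ∑ b(e_{i₁}, …, e_{i_k}) vol(e_{i₁}, …, e_{i_k}, w)`, the sum being over all
`k`-tuples of indices. This is the form with `a ∧ *b = ⟨a, b⟩ vol` for all `k`-forms `a`; it does
not depend on the orthonormal basis. -/
def hodge [Fact (Module.finrank ℝ V = n)] (o : Orientation ℝ V (Fin n)) (h : k + l = n)
    (b : V [⋀^Fin k]→ₗ[ℝ] ℝ) : V [⋀^Fin l]→ₗ[ℝ] ℝ :=
  ((k.factorial : ℝ)⁻¹) • ∑ f : Fin k → Fin (Module.finrank ℝ V),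
    b (fun i => stdOrthonormalBasis ℝ V (f i)) •
      insertLeft h o.volumeForm (fun i => stdOrthonormalBasis ℝ V (f i))

/-- The vector `â` metrically dual to a `1`-form `a`: `⟨â, w⟩ = a(w)`. -/
def sharp (a : V [⋀^Fin 1]→ₗ[ℝ] ℝ) : V :=
  (InnerProductSpace.toDual ℝ V).symm
    (LinearMap.toContinuousLinearMap ((AlternatingMap.ofSubsingleton ℝ V ℝ (0 : Fin 1)).symm a))

end Linear

/-! ### Differential forms on a manifold (possibly with boundary) -/

section Forms

variable {n : ℕ} {H : Type*} [TopologicalSpace H]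
  (I : ModelWithCorners ℝ (EuclideanSpace ℝ (Fin n)) H)
  (M : Type*) [TopologicalSpace M] [ChartedSpace H M]

/-- Fields of alternating `k`-forms on the tangent spaces of `M`, without regularity. -/
abbrev DiffForm (k : ℕ) : Type _ := ∀ x : M, (TangentSpace I x) [⋀^Fin k]→ₗ[ℝ] ℝ

variable {I M}

/-- The expression of a form in the chart around `x₀`: its pullback under the inverse chart. -/
def chartPullback {k : ℕ} (x₀ : M) (η : DiffForm I M k) (y : EuclideanSpace ℝ (Fin n)) :
    (EuclideanSpace ℝ (Fin n)) [⋀^Fin k]→ₗ[ℝ] ℝ :=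
  (η ((extChartAt I x₀).symm y)).compLinearMap
    (mfderivWithin 𝓘(ℝ, EuclideanSpace ℝ (Fin n)) I (extChartAt I x₀).symm (range I) y).toLinearMap

/-- A form is smooth if its components in every chart are smooth. -/
def IsSmoothForm {k : ℕ} (η : DiffForm I M k) : Prop :=
  ∀ (x₀ : M) (v : Fin k → EuclideanSpace ℝ (Fin n)),
    ContDiffOn ℝ ∞ (fun y => chartPullback x₀ η y v) (extChartAt I x₀).target

/-- The standard basis of the model space. -/
def stdFrame (n : ℕ) : Fin n → EuclideanSpace ℝ (Fin n) := fun i => EuclideanSpace.single i 1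

/-- The sign (`1` or `-1`) of the coordinate frame of the chart around `x₀`, at the point with
coordinates `y`, with respect to a choice of orientations of the tangent spaces. -/
def chartSign (o : ∀ x : M, Orientation ℝ (TangentSpace I x) (Fin n)) (x₀ : M)
    (y : EuclideanSpace ℝ (Fin n)) : ℝ :=
  SignType.sign (chartPullback x₀ (fun x => (o x).someVector) y (stdFrame n))

variable (I M) in
/-- An orientation of `M`: orientations of all tangent spaces such that the sign of the coordinate
frame of every chart is locally constant. -/
structure ManifoldOrientation where
  /-- the orientation of the tangent space at `x` -/
  orient (x : M) : Orientation ℝ (TangentSpace I x) (Fin n)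
  continuousOn_chartSign (x₀ : M) : ContinuousOn (chartSign orient x₀) (extChartAt I x₀).target

variable [IsManifold I ∞ M] [CompactSpace M] [T2Space M]

variable (I M) in
/-- A smooth partition of unity subordinate to the covering of `M` by its charts. -/
def partitionOfUnity : SmoothPartitionOfUnity M I M univ :=
  (SmoothPartitionOfUnity.exists_isSubordinate_chartAt_source I M).choose

/-- The integral over the oriented compact manifold `M` of a form of top degree: the sum over a
partition of unity `ρ` subordinate to the charts of the integrals of the coordinate expressions of
`ρᵢ η`, with the sign `-1` where the chart reverses orientation. -/
def formIntegral (o : ManifoldOrientation I M) (η : DiffForm I M n) : ℝ :=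
  ∑ᶠ x₀ : M, ∫ y in (extChartAt I x₀).target,
    chartSign o.orient x₀ y * partitionOfUnity I M x₀ ((extChartAt I x₀).symm y) *
      chartPullback x₀ η y (stdFrame n)

/-- The pairing `∫_M a ∧ b` of forms of complementary degrees. -/
def pairing {k l : ℕ} (o : ManifoldOrientation I M) (h : k + l = n) (a : DiffForm I M k)
    (b : DiffForm I M l) : ℝ :=
  formIntegral o fun x => wedge h (a x) (b x)

end Forms

/-! ### Variational derivatives and Legendre transforms -/

section Variational

variable {n : ℕ} {H : Type*} [TopologicalSpace H]
  {I : ModelWithCorners ℝ (EuclideanSpace ℝ (Fin n)) H}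
  {M : Type*} [TopologicalSpace M] [ChartedSpace H M]

/-- `d` represents, through the pairing `B`, the directional derivatives of the functional `F` at
`η` in all smooth directions `δ`. -/
def RepresentsDeriv {k l : ℕ} (B : DiffForm I M l → DiffForm I M k → ℝ)
    (F : DiffForm I M k → ℝ) (η : DiffForm I M k) (d : DiffForm I M l) : Prop :=
  ∀ δ : DiffForm I M k, IsSmoothForm δ → HasDerivAt (fun ε : ℝ => F (η + ε • δ)) (B d δ) 0

/-- `d` is the variational derivative of `F` at `η`: the unique smooth form that represents the
directional derivatives of `F` at `η` through the pairing `B`. -/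
def IsVariationalDeriv {k l : ℕ} (B : DiffForm I M l → DiffForm I M k → ℝ)
    (F : DiffForm I M k → ℝ) (η : DiffForm I M k) (d : DiffForm I M l) : Prop :=
  IsSmoothForm d ∧ RepresentsDeriv B F η d ∧
    ∀ d' : DiffForm I M l, IsSmoothForm d' → RepresentsDeriv B F η d' → d' = d

/-- `K` is the Legendre transform of `L` with respect to the pairing `B`: every smooth `β` has a
conjugate momentum (the variational derivative of `L` at `β`), every smooth `α` is the momentum of
exactly one smooth `β`, and `K(α) = B(α, β) - L(β)` whenever `α` is the momentum of `β`. -/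
def IsLegendreTransform {k l : ℕ} (B : DiffForm I M l → DiffForm I M k → ℝ)
    (L : DiffForm I M k → ℝ) (K : DiffForm I M l → ℝ) : Prop :=
  (∀ β : DiffForm I M k, IsSmoothForm β → ∃ α, IsVariationalDeriv B L β α) ∧
  (∀ α : DiffForm I M l, IsSmoothForm α →
    ∃! β : DiffForm I M k, IsSmoothForm β ∧ IsVariationalDeriv B L β α) ∧
  ∀ (β : DiffForm I M k) (α : DiffForm I M l), IsSmoothForm β → IsVariationalDeriv B L β α →
    K α = B α β - L β

end Variational

/-! ### The kinetic energy on an oriented Riemannian manifold -/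

section Kinetic

variable {n : ℕ} {H : Type*} [TopologicalSpace H]
  {I : ModelWithCorners ℝ (EuclideanSpace ℝ (Fin n)) H}
  {M : Type*} [TopologicalSpace M] [ChartedSpace H M]

instance finiteDimensional_tangentSpace (x : M) : FiniteDimensional ℝ (TangentSpace I x) :=
  inferInstanceAs (FiniteDimensional ℝ (EuclideanSpace ℝ (Fin n)))

instance fact_finrank_tangentSpace (x : M) :
    Fact (Module.finrank ℝ (TangentSpace I x) = n) :=
  ⟨finrank_euclideanSpace_fin (𝕜 := ℝ)⟩

variable [RiemannianBundle (fun x : M => TangentSpace I x)]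

/-- The Hodge star on forms. -/
def hodgeStar {k l : ℕ} (o : ManifoldOrientation I M) (h : k + l = n) (η : DiffForm I M k) :
    DiffForm I M l :=
  fun x => hodge (o.orient x) h (η x)

/-- The `0`-form `*μ` of a top form `μ`, as a function. -/
def density (o : ManifoldOrientation I M) (μ : DiffForm I M n) (x : M) : ℝ :=
  hodgeStar o (Nat.add_zero n) μ x Fin.elim0

/-- The momentum `(-1)^(n-1) (*μ) *β`. -/
def momentum (hn : 1 ≤ n) (o : ManifoldOrientation I M) (β : DiffForm I M (n - 1))
    (μ : DiffForm I M n) : DiffForm I M 1 :=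
  fun x => ((-1) ^ (n - 1) * density o μ x) • hodgeStar o (Nat.sub_add_cancel hn) β x

/-- The `(n-1)`-form `*α / *μ`. -/
def velocityForm (hn : 1 ≤ n) (o : ManifoldOrientation I M) (α : DiffForm I M 1)
    (μ : DiffForm I M n) : DiffForm I M (n - 1) :=
  fun x => (density o μ x)⁻¹ • hodgeStar o (Nat.add_sub_of_le hn) α x

/-- The `0`-form `-(1 / (2 (*μ)²)) ι_α̂ α`. -/
def massEffort (o : ManifoldOrientation I M) (α : DiffForm I M 1) (μ : DiffForm I M n) :
    DiffForm I M 0 :=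
  fun x => (-(1 / (2 * density o μ x ^ 2))) • (α x).curryLeft (sharp (α x))

variable [IsManifold I ∞ M] [CompactSpace M] [T2Space M]

/-- The reduced Lagrangian `L_k(β, μ) = ∫_M ½ (*μ) β ∧ *β`. -/
def lagrangian (hn : 1 ≤ n) (o : ManifoldOrientation I M) (β : DiffForm I M (n - 1))
    (μ : DiffForm I M n) : ℝ :=
  formIntegral o fun x => (1 / 2 * density o μ x) •
    wedge (Nat.sub_add_cancel hn) (β x) (hodgeStar o (Nat.sub_add_cancel hn) β x)

/-- The Hamiltonian `H_k(α, μ) = ∫_M (1 / (2 (*μ))) α ∧ *α`. -/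
def hamiltonian (hn : 1 ≤ n) (o : ManifoldOrientation I M) (α : DiffForm I M 1)
    (μ : DiffForm I M n) : ℝ :=
  formIntegral o fun x => (1 / (2 * density o μ x)) •
    wedge (Nat.add_sub_of_le hn) (α x) (hodgeStar o (Nat.add_sub_of_le hn) α x)

end Kinetic

end FluidKinetic

end

open FluidKinetic

/-!
Integration against the Riemannian volume form is integration against a finite measure with full
support. Through it `L_k` and `H_k` become one and the same quadratic functional
`∫ ½ w ⟨β, β⟩`, with weights `w = *μ` and `w = 1 / *μ`, whose derivative at `β` is paired with `δ`
as `∫ δ ∧ w *β`. Reordering the wedge product gives the sign `(-1)^(k l)`, and since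
`** = (-1)^(k l)` the momentum map of the weight `w` is inverted by that of `1 / w`, which is the
Legendre duality. Variational derivatives are unique because a form `η` whose
pairing with every smooth form vanishes can be tested against `*η`, which gives `∫ ⟨η, η⟩ = 0`.
-/

namespace FluidKinetic

section Wedge

variable {k l n : ℕ}

/-- The permutation of `Fin n` that moves an initial block of length `k` past the complementary
block of length `l`. -/
def blockSwap (h : k + l = n) (h' : l + k = n) : Equiv.Perm (Fin n) :=
  (finCongr h).symm.trans (finAddFlip.trans (finCongr h'))

@[simp]
theorem blockSwap_castAdd (h : k + l = n) (h' : l + k = n) (i : Fin k) :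
    blockSwap h h' (Fin.cast h (Fin.castAdd l i)) = Fin.cast h' (Fin.natAdd l i) := by
  simp [blockSwap]

@[simp]
theorem blockSwap_natAdd (h : k + l = n) (h' : l + k = n) (j : Fin l) :
    blockSwap h h' (Fin.cast h (Fin.natAdd k j)) = Fin.cast h' (Fin.castAdd k j) := by
  simp [blockSwap]

theorem coe_finRotate_pow_apply (n m : ℕ) (i : Fin (n + 1)) :
    (((finRotate (n + 1)) ^ m) i : ℕ) = (i + m) % (n + 1) := by
  induction m with
  | zero => simp [Nat.mod_eq_of_lt i.is_lt]
  | succ m ih =>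
    rw [pow_succ', Equiv.Perm.mul_apply, finRotate_apply, Fin.val_add, ih, Fin.val_one',
      ← Nat.add_mod, add_assoc]

theorem blockSwap_eq_finRotate_pow (h : k + l = n) (h' : l + k = n) :
    blockSwap h h' = finRotate n ^ l := by
  ext i
  obtain rfl | m := n
  · exact i.elim0
  rw [coe_finRotate_pow_apply]
  obtain ⟨i, rfl⟩ := (finCongr h).surjective i
  induction i using Fin.addCases with
  | left i =>
    simp only [finCongr_apply, blockSwap_castAdd, Fin.val_cast, Fin.val_natAdd, Fin.val_castAdd]
    rw [Nat.mod_eq_of_lt (by lia), add_comm]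
  | right j =>
    simp only [finCongr_apply, blockSwap_natAdd, Fin.val_cast, Fin.val_castAdd, Fin.val_natAdd]
    rw [show k + (j : ℕ) + l = j + (m + 1) by lia, Nat.add_mod_right, Nat.mod_eq_of_lt (by lia)]

theorem sign_blockSwap (h : k + l = n) (h' : l + k = n) :
    Equiv.Perm.sign (blockSwap h h') = (-1) ^ (k * l) := by
  obtain rfl | l := l
  · simp [blockSwap_eq_finRotate_pow]
  have hpar : (n - 1) * (l + 1) = k * (l + 1) + l * (l + 1) := by
    rw [← add_mul]; congr 1; lia
  rw [blockSwap_eq_finRotate_pow, map_pow, sign_finRotate, ← pow_mul, hpar, pow_add,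
    (Nat.even_mul_succ_self l).neg_one_pow, mul_one]

theorem concat_rfl {V : Type*} (u : Fin k → V) (w : Fin l → V) :
    concat rfl u w = Fin.append u w := by
  funext i
  induction i using Fin.addCases <;> simp [concat]

theorem concat_comp {V W : Type*} (h : k + l = n) (g : V → W) (u : Fin k → V) (w : Fin l → V) :
    concat h (g ∘ u) (g ∘ w) = g ∘ concat h u w := by
  subst h
  funext i
  induction i using Fin.addCases <;> simp [concat_rfl]

theorem concat_eq_comp_blockSwap {V : Type*} (h : k + l = n) (h' : l + k = n) (u : Fin k → V)
    (w : Fin l → V) : concat h u w = concat h' w u ∘ blockSwap h h' := by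
  funext i
  obtain ⟨i, rfl⟩ := (finCongr h).surjective i
  induction i using Fin.addCases <;> simp [concat]

variable {V : Type*} [AddCommGroup V] [Module ℝ V]

theorem sum_alternatingMap_apply {ι κ : Type*} (s : Finset κ) (f : κ → V [⋀^ι]→ₗ[ℝ] ℝ)
    (v : ι → V) : (∑ i ∈ s, f i) v = ∑ i ∈ s, f i v :=
  map_sum (AddMonoidHom.mk' (fun g : V [⋀^ι]→ₗ[ℝ] ℝ => g v) fun _ _ => rfl) f s

theorem map_comp_perm {ι : Type*} [Fintype ι] [DecidableEq ι] (η : V [⋀^ι]→ₗ[ℝ] ℝ) (v : ι → V)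
    (σ : Equiv.Perm ι) : η (v ∘ σ) = (Equiv.Perm.sign σ : ℤ) * η v := by
  rw [η.map_perm, Units.smul_def, zsmul_eq_mul]

theorem map_concat_swap (h : k + l = n) (h' : l + k = n) (η : V [⋀^Fin n]→ₗ[ℝ] ℝ)
    (u : Fin k → V) (w : Fin l → V) :
    η (concat h u w) = (-1) ^ (k * l) * η (concat h' w u) := by
  rw [concat_eq_comp_blockSwap h h', map_comp_perm, sign_blockSwap]
  simp

/-- Repeated arguments kill an alternating map, so only permutations contribute. -/
theorem sum_map_comp_mul_eq_sum_perm {ι : Type*} [Fintype ι] [DecidableEq ι]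
    (η : V [⋀^ι]→ₗ[ℝ] ℝ) (e : ι → V) (F : (ι → ι) → ℝ) :
    ∑ g : ι → ι, η (e ∘ g) * F g =
      η e * ∑ σ : Equiv.Perm ι, (Equiv.Perm.sign σ : ℤ) * F σ := by
  rw [Finset.mul_sum]
  refine (Fintype.sum_of_injective (fun σ : Equiv.Perm ι => (σ : ι → ι))
    DFunLike.coe_injective _ _ (fun g hg => ?_) fun σ => ?_).symm
  · have hinj : ¬ Function.Injective g := fun hi =>
      hg ⟨Equiv.ofBijective g (Finite.injective_iff_bijective.1 hi), rfl⟩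
    rw [η.map_eq_zero_of_not_injective _ fun hi => hinj hi.of_comp, zero_mul]
  · rw [map_comp_perm]
    ring

theorem sum_map_comp_mul_map_comp {ι : Type*} [Fintype ι] [DecidableEq ι]
    (η θ : V [⋀^ι]→ₗ[ℝ] ℝ) (e : ι → V) :
    ∑ g : ι → ι, η (e ∘ g) * θ (e ∘ g) = (Fintype.card ι).factorial * (η e * θ e) := by
  have hsign (σ : Equiv.Perm ι) :
      ((Equiv.Perm.sign σ : ℤ) : ℝ) * ((Equiv.Perm.sign σ : ℤ) * θ e) = θ e := by
    rw [← mul_assoc, ← Int.cast_mul, Int.units_coe_mul_self, Int.cast_one, one_mul]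
  rw [sum_map_comp_mul_eq_sum_perm η e fun g => θ (e ∘ g)]
  simp only [map_comp_perm, hsign, Finset.sum_const, Finset.card_univ, Fintype.card_perm,
    nsmul_eq_mul]
  ring

theorem map_concat_eq_zero_of_notMem_range (η : V [⋀^Fin (k + l)]→ₗ[ℝ] ℝ) (e : Fin (k + l) → V)
    {f : Fin k → Fin (k + l)}
    (hf : f ∉ range fun g : Fin k → Fin k => Fin.castAdd l ∘ g) :
    η (concat rfl (e ∘ f) (e ∘ Fin.natAdd k)) = 0 := by
  rw [concat_comp, concat_rfl]
  refine η.map_eq_zero_of_not_injective _ fun hinj => hf ?_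
  have hleft (i : Fin k) : ∃ j, Fin.castAdd l j = f i := by
    obtain hj | ⟨j, hj⟩ : (∃ j, Fin.castAdd l j = f i) ∨ ∃ j, Fin.natAdd k j = f i := by
      induction f i using Fin.addCases <;> simp
    · exact hj
    · have heq : Fin.natAdd k j = Fin.castAdd l i :=
        hinj.of_comp (by rw [Fin.append_right, Fin.append_left, hj])
      exact absurd (congrArg Fin.val heq) (by simp; lia)
  choose g hg using hleft
  exact ⟨g, funext hg⟩

theorem factorial_mul_factorial_mul_wedge_apply (h : k + l = n) (a : V [⋀^Fin k]→ₗ[ℝ] ℝ)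
    (b : V [⋀^Fin l]→ₗ[ℝ] ℝ) (v : Fin n → V) :
    (k.factorial * l.factorial : ℝ) * wedge h a b v =
      ∑ σ : Equiv.Perm (Fin n), (Equiv.Perm.sign σ : ℤ) *
        (a (fun i => v (σ (Fin.cast h (Fin.castAdd l i)))) *
          b fun j => v (σ (Fin.cast h (Fin.natAdd k j)))) := by
  subst h
  have hsum := congrArg (fun m => LinearMap.mul' ℝ ℝ (m fun s => v (finSumFinEquiv s)))
    (MultilinearMap.domCoprod_alternization_eq a b)
  simp only [Fintype.card_fin, MultilinearMap.alternatization_apply, map_sum,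
    AlternatingMap.smul_apply, map_nsmul] at hsum
  rw [← Nat.cast_mul, ← nsmul_eq_mul]
  refine hsum.symm.trans (Fintype.sum_equiv finSumFinEquiv.permCongr _ _ fun σ => ?_)
  rw [Units.smul_def, map_zsmul, zsmul_eq_mul, Equiv.Perm.sign_permCongr]
  simp [Equiv.permCongr_apply]

theorem wedge_comm (h : k + l = n) (h' : l + k = n) (a : V [⋀^Fin k]→ₗ[ℝ] ℝ)
    (b : V [⋀^Fin l]→ₗ[ℝ] ℝ) : wedge h' b a = (-1 : ℝ) ^ (k * l) • wedge h a b := by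
  ext v
  refine mul_left_cancel₀ (b := wedge h' b a v)
    (show (k.factorial * l.factorial : ℝ) ≠ 0 by positivity) ?_
  rw [AlternatingMap.smul_apply, smul_eq_mul, mul_left_comm,
    factorial_mul_factorial_mul_wedge_apply, mul_comm (k.factorial : ℝ),
    factorial_mul_factorial_mul_wedge_apply, Finset.mul_sum]
  refine Fintype.sum_equiv (Equiv.mulRight (blockSwap h h')) _ _ fun σ => ?_
  simp only [Equiv.coe_mulRight, Equiv.Perm.mul_apply, blockSwap_castAdd, blockSwap_natAdd,
    map_mul, sign_blockSwap, Units.val_mul, Int.cast_mul, Units.val_pow_eq_pow_val, Units.val_neg,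
    Units.val_one, Int.cast_pow, Int.cast_neg, Int.cast_one]
  have hsq : ((-1 : ℝ) ^ (k * l)) * (-1) ^ (k * l) = 1 := by rw [← mul_pow]; simp
  linear_combination -((Equiv.Perm.sign σ : ℤ) *
    (b (fun i => v (σ (Fin.cast h' (Fin.castAdd k i)))) *
      a fun j => v (σ (Fin.cast h' (Fin.natAdd l j))))) * hsq

theorem eq_of_apply_basis_eq {η θ : V [⋀^Fin n]→ₗ[ℝ] ℝ} (e : Module.Basis (Fin n) ℝ V)
    (h : η e = θ e) : η = θ := by
  rw [η.eq_smul_basis_det e, θ.eq_smul_basis_det e, h]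

end Wedge

section FormInner

variable {k : ℕ} {V : Type*} [NormedAddCommGroup V] [InnerProductSpace ℝ V]

theorem gram_mul_sum_repr {ι κ : Type*} [Fintype ι] [Fintype κ] [DecidableEq κ]
    (e : OrthonormalBasis ι ℝ V) (v : Module.Basis κ ℝ V) :
    Matrix.gram ℝ v * Matrix.of (fun i j => ∑ p, v.repr (e p) i * v.repr (e p) j) = 1 := by
  ext i j
  have hexpand (p : ι) : ∑ m, inner ℝ (v i) (v m) * v.repr (e p) m = inner ℝ (v i) (e p) := by
    conv_rhs => rw [← v.sum_repr (e p), inner_sum]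
    simp only [inner_smul_right, mul_comm]
  calc ∑ m, inner ℝ (v i) (v m) * ∑ p, v.repr (e p) m * v.repr (e p) j
      = ∑ p, (∑ m, inner ℝ (v i) (v m) * v.repr (e p) m) * v.repr (e p) j := by
        simp only [Finset.mul_sum, Finset.sum_mul]
        rw [Finset.sum_comm]
        simp only [mul_assoc]
    _ = v.repr (∑ p, inner ℝ (e p) (v i) • e p) j := by
        simp only [hexpand, map_sum, map_smul, Finsupp.finsetSum_apply, Finsupp.smul_apply,
          smul_eq_mul, real_inner_comm]
    _ = (1 : Matrix κ κ ℝ) i j := by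
        rw [e.sum_repr', v.repr_self, Matrix.one_apply, Finsupp.single_apply]

theorem map_eq_sum_repr {ι κ : Type*} [Fintype ι] [DecidableEq ι] [Fintype κ]
    (m : MultilinearMap ℝ (fun _ : ι => V) ℝ) (v : Module.Basis κ ℝ V) (w : ι → V) :
    m w = ∑ f : ι → κ, (∏ i, v.repr (w i) (f i)) * m (v ∘ f) := by
  conv_lhs => rw [show w = fun i => ∑ j, v.repr (w i) j • v j from
    funext fun i => (v.sum_repr _).symm]
  rw [m.map_sum]
  exact Finset.sum_congr rfl fun f _ => m.map_smul_univ _ _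

variable [FiniteDimensional ℝ V]

/-- The inner product `⟨a, b⟩ = (1 / k!) ∑ a(e_{i₁}, …, e_{i_k}) b(e_{i₁}, …, e_{i_k})` of
`k`-forms, for which the forms `e^{i₁} ∧ ⋯ ∧ e^{i_k}`, `i₁ < ⋯ < i_k`, are orthonormal. -/
noncomputable def formInner : LinearMap.BilinForm ℝ (V [⋀^Fin k]→ₗ[ℝ] ℝ) :=
  LinearMap.mk₂ ℝ
    (fun a b => (k.factorial : ℝ)⁻¹ * ∑ f : Fin k → Fin (Module.finrank ℝ V),
      a (stdOrthonormalBasis ℝ V ∘ f) * b (stdOrthonormalBasis ℝ V ∘ f))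
    (fun a a' b => by
      simp only [AlternatingMap.add_apply, add_mul, Finset.sum_add_distrib, mul_add])
    (fun c a b => by
      simp only [AlternatingMap.smul_apply, smul_eq_mul, mul_assoc, ← Finset.mul_sum]
      ring)
    (fun a b b' => by
      simp only [AlternatingMap.add_apply, mul_add, Finset.sum_add_distrib])
    (fun c a b => by
      simp only [AlternatingMap.smul_apply, smul_eq_mul, mul_left_comm _ c, ← Finset.mul_sum])

theorem formInner_apply (a b : V [⋀^Fin k]→ₗ[ℝ] ℝ) :
    formInner a b = (k.factorial : ℝ)⁻¹ * ∑ f : Fin k → Fin (Module.finrank ℝ V),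
      a (stdOrthonormalBasis ℝ V ∘ f) * b (stdOrthonormalBasis ℝ V ∘ f) := rfl

theorem formInner_comm (a b : V [⋀^Fin k]→ₗ[ℝ] ℝ) : formInner a b = formInner b a := by
  simp only [formInner_apply, mul_comm]

theorem formInner_self_nonneg (a : V [⋀^Fin k]→ₗ[ℝ] ℝ) : 0 ≤ formInner a a :=
  mul_nonneg (by positivity) (Finset.sum_nonneg fun f _ => mul_self_nonneg _)

theorem formInner_self_eq_zero {a : V [⋀^Fin k]→ₗ[ℝ] ℝ} : formInner a a = 0 ↔ a = 0 := by
  refine ⟨fun h => ?_, fun h => by rw [h, map_zero]⟩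
  rw [formInner_apply, mul_eq_zero, or_iff_right (by positivity),
    Finset.sum_eq_zero_iff_of_nonneg fun f _ => mul_self_nonneg _] at h
  refine Module.Basis.ext_alternating (stdOrthonormalBasis ℝ V).toBasis fun f _ => ?_
  simpa using! h f (Finset.mem_univ f)

theorem formInner_eq_sum_basis {κ : Type*} [Fintype κ] [DecidableEq κ] (v : Module.Basis κ ℝ V)
    (a b : V [⋀^Fin k]→ₗ[ℝ] ℝ) :
    formInner a b = (k.factorial : ℝ)⁻¹ * ∑ f : Fin k → κ, ∑ g : Fin k → κ,
      (∏ i, (Matrix.gram ℝ v)⁻¹ (f i) (g i)) * (a (v ∘ f) * b (v ∘ g)) := by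
  rw [formInner_apply]
  set e := stdOrthonormalBasis ℝ V
  have hexpand (m : V [⋀^Fin k]→ₗ[ℝ] ℝ) (p : Fin k → Fin (Module.finrank ℝ V)) :
      m (e ∘ p) = ∑ f : Fin k → κ, (∏ i, v.repr (e (p i)) (f i)) * m (v ∘ f) :=
    map_eq_sum_repr m.toMultilinearMap v (e ∘ p)
  rw [Matrix.inv_eq_right_inv (gram_mul_sum_repr e v)]
  congr 1
  simp only [hexpand, Matrix.of_apply, Finset.prod_univ_sum, Fintype.piFinset_univ,
    Finset.sum_mul_sum]
  simp only [Finset.sum_mul, Finset.prod_mul_distrib]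
  rw [Finset.sum_comm]
  refine Finset.sum_congr rfl fun f _ => ?_
  rw [Finset.sum_comm]
  exact Finset.sum_congr rfl fun g _ => Finset.sum_congr rfl fun p _ => by ring

theorem formInner_eq_sum {ι : Type*} [Fintype ι] (e : OrthonormalBasis ι ℝ V)
    (a b : V [⋀^Fin k]→ₗ[ℝ] ℝ) :
    formInner a b = (k.factorial : ℝ)⁻¹ * ∑ f : Fin k → ι, a (e ∘ f) * b (e ∘ f) := by
  classical
  have hgram : Matrix.gram ℝ e = 1 := Matrix.gram_eq_one_iff_orthonormal.2 e.orthonormal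
  rw [formInner_eq_sum_basis e.toBasis, OrthonormalBasis.coe_toBasis, hgram, inv_one]
  congr 1
  refine Finset.sum_congr rfl fun f _ =>
    (Finset.sum_eq_single f (fun g _ hg => ?_) (by simp)).trans (by simp)
  obtain ⟨i, hi⟩ := Function.ne_iff.1 hg
  have hentry : (1 : Matrix ι ι ℝ) (f i) (g i) = 0 := Matrix.one_apply_ne hi.symm
  exact mul_eq_zero_of_left (Finset.prod_eq_zero (Finset.mem_univ i) hentry) _

theorem apply_eq_inner_sharp (a : V [⋀^Fin 1]→ₗ[ℝ] ℝ) (v : Fin 1 → V) :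
    a v = inner ℝ (sharp a) (v 0) := by
  rw [sharp, InnerProductSpace.toDual_symm_apply]
  exact congrArg a (funext fun i => congrArg v (Subsingleton.elim i 0))

theorem curryLeft_sharp_self (a : V [⋀^Fin 1]→ₗ[ℝ] ℝ) (w : Fin 0 → V) :
    a.curryLeft (sharp a) w = formInner a a := by
  rw [AlternatingMap.curryLeft_apply_apply, apply_eq_inner_sharp, Matrix.cons_val_zero,
    formInner_apply, Nat.factorial_one, Nat.cast_one, inv_one, one_mul,
    ← (stdOrthonormalBasis ℝ V).sum_inner_mul_inner]
  refine (Fintype.sum_equiv (Equiv.funUnique (Fin 1) _) _ _ fun f => ?_).symm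
  rw [apply_eq_inner_sharp, real_inner_comm (sharp a) (stdOrthonormalBasis ℝ V _)]
  rfl

end FormInner

section Hodge

variable {k l n : ℕ} {V : Type*} [NormedAddCommGroup V] [InnerProductSpace ℝ V]
  [Fact (Module.finrank ℝ V = n)] (o : Orientation ℝ V (Fin n))

theorem volumeForm_mul_self (e : OrthonormalBasis (Fin n) ℝ V) :
    o.volumeForm e * o.volumeForm e = 1 := by
  rw [← abs_mul_abs_self, o.abs_volumeForm_apply_of_orthonormal, one_mul]

variable [FiniteDimensional ℝ V]

/-- The `Fin n`-indexed orthonormal basis of an `n`-dimensional space that underlies the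
definition of the Hodge star. -/
noncomputable def orthonormalFrame (n : ℕ) (V : Type*) [NormedAddCommGroup V]
    [InnerProductSpace ℝ V] [FiniteDimensional ℝ V] [Fact (Module.finrank ℝ V = n)] :
    OrthonormalBasis (Fin n) ℝ V :=
  (stdOrthonormalBasis ℝ V).reindex (finCongr Fact.out)

theorem volumeForm_sq (v : Fin n → V) : o.volumeForm v ^ 2 = (Matrix.gram ℝ v).det := by
  rw [Matrix.gram_eq_conjTranspose_mul (orthonormalFrame n V), Matrix.det_mul,
    Matrix.det_conjTranspose, star_trivial, ← sq, ← sq_abs,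
    o.volumeForm_robust' (orthonormalFrame n V), sq_abs, Module.Basis.det_apply]
  rfl

theorem exists_someVector_eq_smul_volumeForm :
    ∃ c : ℝ, 0 < c ∧ o.someVector = c • o.volumeForm := by
  set e := orthonormalFrame n V
  have hvol : o.volumeForm ≠ 0 := fun h => by simpa [h] using volumeForm_mul_self o e
  suffices hray : SameRay ℝ o.volumeForm o.someVector by
    obtain ⟨c, hc, h⟩ := hray.exists_pos_left hvol o.someVector_ne_zero
    exact ⟨c, hc, h.symm⟩
  rw [← ray_eq_iff hvol o.someVector_ne_zero, o.someVector_ray]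
  by_cases he : e.toBasis.orientation = o
  · simp only [o.volumeForm_robust e he]
    exact he
  · simp only [o.volumeForm_robust_neg e he]
    rw [← neg_rayOfNeZero ℝ _ e.toBasis.det_ne_zero]
    exact ((e.toBasis.orientation_ne_iff_eq_neg o).1 (Ne.symm he)).symm

theorem hodge_apply (h : k + l = n) (h' : l + k = n) (b : V [⋀^Fin k]→ₗ[ℝ] ℝ) (w : Fin l → V) :
    hodge o h b w = (-1) ^ (k * l) * formInner b (insertLeft h' o.volumeForm w) := by
  have hinsert (u : Fin k → V) : insertLeft h o.volumeForm u w =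
      (-1) ^ (k * l) * insertLeft h' o.volumeForm w u := map_concat_swap h h' _ u w
  rw [hodge, AlternatingMap.smul_apply, sum_alternatingMap_apply, formInner_apply, smul_eq_mul,
    mul_left_comm]
  congr 1
  rw [Finset.mul_sum]
  refine Finset.sum_congr rfl fun f _ => ?_
  rw [AlternatingMap.smul_apply, hinsert, smul_eq_mul, mul_left_comm]
  rfl

/-- The Hodge star as a linear map. -/
noncomputable def hodgeₗ (h : k + l = n) : (V [⋀^Fin k]→ₗ[ℝ] ℝ) →ₗ[ℝ] (V [⋀^Fin l]→ₗ[ℝ] ℝ) where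
  toFun := hodge o h
  map_add' a b := by
    ext w
    simp only [AlternatingMap.add_apply, hodge_apply o h ((add_comm l k).trans h), map_add,
      LinearMap.add_apply, mul_add]
  map_smul' c a := by
    ext w
    simp only [AlternatingMap.smul_apply, hodge_apply o h ((add_comm l k).trans h), map_smul,
      LinearMap.smul_apply, smul_eq_mul, RingHom.id_apply, mul_left_comm c]

theorem hodgeₗ_apply (h : k + l = n) (b : V [⋀^Fin k]→ₗ[ℝ] ℝ) : hodgeₗ o h b = hodge o h b := rfl

theorem hodge_apply_eq_sum {ι : Type*} [Fintype ι] (h : k + l = n) (e : OrthonormalBasis ι ℝ V)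
    (b : V [⋀^Fin k]→ₗ[ℝ] ℝ) (w : Fin l → V) :
    hodge o h b w = (k.factorial : ℝ)⁻¹ * ∑ f : Fin k → ι,
      b (e ∘ f) * o.volumeForm (concat h (e ∘ f) w) := by
  have h' : l + k = n := (add_comm l k).trans h
  rw [hodge_apply o h h', formInner_eq_sum e, mul_left_comm, Finset.mul_sum]
  congr 1
  refine Finset.sum_congr rfl fun f _ => ?_
  rw [map_concat_swap h h', mul_left_comm]
  rfl

theorem hodge_apply_orthonormalBasis (h : k + l = n) (e : OrthonormalBasis (Fin n) ℝ V)
    (b : V [⋀^Fin k]→ₗ[ℝ] ℝ) :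
    hodge o h b (fun j => e (Fin.cast h (Fin.natAdd k j))) =
      o.volumeForm e * b fun i => e (Fin.cast h (Fin.castAdd l i)) := by
  subst h
  set u : Fin k → V := e ∘ Fin.castAdd l
  set w : Fin l → V := e ∘ Fin.natAdd k
  have h' : l + k = k + l := add_comm l k
  set ν := (-1 : ℝ) ^ (k * l) • insertLeft h' o.volumeForm w
  have hν (v : Fin k → V) : ν v = o.volumeForm (concat rfl v w) :=
    (map_concat_swap rfl h' o.volumeForm v w).symm
  have hu : o.volumeForm (concat rfl u w) = o.volumeForm e := by
    rw [concat_comp, concat_rfl, show Fin.append (Fin.castAdd l) (Fin.natAdd k) = id from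
      funext fun i => by induction i using Fin.addCases <;> simp, Function.comp_id]
  have hsum : ∑ f : Fin k → Fin (k + l), b (e ∘ f) * o.volumeForm (concat rfl (e ∘ f) w) =
      ∑ g : Fin k → Fin k, b (u ∘ g) * ν (u ∘ g) := by
    refine (Fintype.sum_of_injective (fun g : Fin k → Fin k => Fin.castAdd l ∘ g)
      (Fin.castAdd_injective k l).comp_left _ _ (fun f hf => ?_) fun g => ?_).symm
    · rw [map_concat_eq_zero_of_notMem_range _ e hf, mul_zero]
    · rw [hν]
      rfl
  calc hodge o rfl b w = b u * ν u := by
        rw [hodge_apply_eq_sum o rfl e, hsum, sum_map_comp_mul_map_comp, Fintype.card_fin,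
          inv_mul_cancel_left₀ (by positivity)]
    _ = o.volumeForm e * b u := by rw [hν, hu, mul_comm]

theorem hodge_hodge (h : k + l = n) (h' : l + k = n) (b : V [⋀^Fin k]→ₗ[ℝ] ℝ) :
    hodge o h' (hodge o h b) = (-1 : ℝ) ^ (k * l) • b := by
  refine Module.Basis.ext_alternating (orthonormalFrame n V).toBasis fun f hf => ?_
  obtain ⟨σ, hσ⟩ := Equiv.Perm.exists_extending_pair (fun i => Fin.cast h (Fin.castAdd l i)) f
    ((Fin.cast_injective h).comp (Fin.castAdd_injective k l)) hf
  set e := (orthonormalFrame n V).reindex σ.symm with he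
  have hfe : (fun i => (orthonormalFrame n V).toBasis (f i)) =
      fun i => e (Fin.cast h (Fin.castAdd l i)) := by
    funext i
    simp [he, ← hσ]
  have hsecond := hodge_apply_orthonormalBasis o h' (e.reindex (blockSwap h h')) (hodge o h b)
  have hswap_natAdd (i : Fin k) :
      (blockSwap h h').symm (Fin.cast h' (Fin.natAdd l i)) = Fin.cast h (Fin.castAdd l i) :=
    (Equiv.symm_apply_eq _).2 (blockSwap_castAdd h h' i).symm
  have hswap_castAdd (j : Fin l) :
      (blockSwap h h').symm (Fin.cast h' (Fin.castAdd k j)) = Fin.cast h (Fin.natAdd k j) :=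
    (Equiv.symm_apply_eq _).2 (blockSwap_natAdd h h' j).symm
  have hvol : o.volumeForm (e.reindex (blockSwap h h')) = (-1) ^ (k * l) * o.volumeForm e := by
    rw [OrthonormalBasis.coe_reindex, map_comp_perm, Equiv.Perm.sign_symm, sign_blockSwap]
    simp
  simp only [OrthonormalBasis.reindex_apply, hswap_natAdd, hswap_castAdd, hvol,
    hodge_apply_orthonormalBasis o h e] at hsecond
  rw [hfe, hsecond, AlternatingMap.smul_apply, smul_eq_mul, mul_assoc,
    ← mul_assoc (o.volumeForm e), volumeForm_mul_self, one_mul]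

theorem wedge_eq_formInner_hodge_smul (h : k + l = n) (a : V [⋀^Fin k]→ₗ[ℝ] ℝ)
    (b : V [⋀^Fin l]→ₗ[ℝ] ℝ) : wedge h a b = formInner (hodge o h a) b • o.volumeForm := by
  subst h
  set e := orthonormalFrame (k + l) V
  refine eq_of_apply_basis_eq e.toBasis ?_
  set A := ∑ g : Fin l → Fin (k + l), ∑ f : Fin k → Fin (k + l),
    o.volumeForm (e ∘ Fin.append f g) * (a (e ∘ f) * b (e ∘ g)) with hA
  have hwedge : A = o.volumeForm e * (k.factorial * l.factorial * wedge rfl a b e) := by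
    rw [factorial_mul_factorial_mul_wedge_apply, ← sum_map_comp_mul_eq_sum_perm o.volumeForm e
      fun f => a (fun i => e (f (Fin.cast rfl (Fin.castAdd l i)))) *
        b fun j => e (f (Fin.cast rfl (Fin.natAdd k j))),
      ← (Fin.appendEquiv k l).sum_comp, Fintype.sum_prod_type_right]
    simp only [hA, Fin.appendEquiv, Equiv.coe_fn_mk, Fin.cast_refl, id, Fin.append_left,
      Fin.append_right]
    rfl
  have hinner : A = k.factorial * l.factorial * formInner (hodge o rfl a) b := by
    rw [formInner_eq_sum e]
    simp only [hodge_apply_eq_sum o rfl e, Finset.sum_mul, Finset.mul_sum, hA]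
    refine Finset.sum_congr rfl fun g _ => Finset.sum_congr rfl fun f _ => ?_
    rw [concat_comp, concat_rfl]
    field_simp
  refine mul_left_cancel₀ (show (k.factorial * l.factorial : ℝ) ≠ 0 by positivity) ?_
  rw [OrthonormalBasis.coe_toBasis, AlternatingMap.smul_apply, smul_eq_mul]
  linear_combination o.volumeForm e * (hinner - hwedge) -
    k.factorial * l.factorial * wedge rfl a b e * volumeForm_mul_self o e

theorem wedge_hodge (h : k + l = n) (a b : V [⋀^Fin k]→ₗ[ℝ] ℝ) :
    wedge h a (hodge o h b) = formInner a b • o.volumeForm := by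
  have h' : l + k = n := (add_comm l k).trans h
  rw [wedge_comm h' h, wedge_eq_formInner_hodge_smul o h', hodge_hodge o h h', map_smul,
    LinearMap.smul_apply, smul_smul, smul_eq_mul, ← mul_assoc, mul_comm l k, ← mul_pow,
    neg_one_mul, neg_neg, one_pow, one_mul, formInner_comm]

end Hodge

section Charts

variable {n : ℕ} {H : Type*} [TopologicalSpace H]
  {I : ModelWithCorners ℝ (EuclideanSpace ℝ (Fin n)) H}
  {M : Type*} [TopologicalSpace M] [ChartedSpace H M]

/-- The coordinate frame of the chart around `x₀` at the point with coordinates `y`. -/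
noncomputable def chartFrame (I : ModelWithCorners ℝ (EuclideanSpace ℝ (Fin n)) H) (x₀ : M)
    (y : EuclideanSpace ℝ (Fin n)) (i : Fin n) : TangentSpace I ((extChartAt I x₀).symm y) :=
  mfderivWithin 𝓘(ℝ, EuclideanSpace ℝ (Fin n)) I (extChartAt I x₀).symm (range I) y (stdFrame n i)

theorem coe_toBasis_basisFun_eq_stdFrame :
    ⇑(EuclideanSpace.basisFun (Fin n) ℝ).toBasis = stdFrame n := by
  funext i
  simp [stdFrame]

theorem symm_mem_chartAt_source {x₀ : M} {y : EuclideanSpace ℝ (Fin n)}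
    (hy : y ∈ (extChartAt I x₀).target) : (extChartAt I x₀).symm y ∈ (chartAt H x₀).source := by
  simpa only [extChartAt_source] using (extChartAt I x₀).map_target hy

theorem exists_basis_chartFrame [IsManifold I 1 M] {x₀ : M} {y : EuclideanSpace ℝ (Fin n)}
    (hy : y ∈ (extChartAt I x₀).target) :
    ∃ v : Module.Basis (Fin n) ℝ (TangentSpace I ((extChartAt I x₀).symm y)),
      ⇑v = chartFrame I x₀ y := by
  obtain ⟨D, hD⟩ := isInvertible_mfderivWithin_extChartAt_symm (I := I) hy
  let e : EuclideanSpace ℝ (Fin n) ≃ₗ[ℝ] TangentSpace I ((extChartAt I x₀).symm y) :=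
    D.toLinearEquiv
  refine ⟨(EuclideanSpace.basisFun (Fin n) ℝ).toBasis.map e, funext fun i => ?_⟩
  rw [Module.Basis.map_apply, coe_toBasis_basisFun_eq_stdFrame, chartFrame, ← hD]
  rfl

theorem localFrame_eq_chartFrame [IsManifold I 1 M] {x₀ : M} {y : EuclideanSpace ℝ (Fin n)}
    (hy : y ∈ (extChartAt I x₀).target) (i : Fin n) :
    (trivializationAt (EuclideanSpace ℝ (Fin n)) (TangentSpace I) x₀).localFrame
      (EuclideanSpace.basisFun (Fin n) ℝ).toBasis i ((extChartAt I x₀).symm y) =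
      chartFrame I x₀ y i := by
  have hx := symm_mem_chartAt_source hy
  have hbase : (extChartAt I x₀).symm y ∈
      (trivializationAt (EuclideanSpace ℝ (Fin n)) (TangentSpace I) x₀).baseSet := by simpa using hx
  have hsymm := TangentBundle.symmL_trivializationAt (I := I) hx
  rw [(extChartAt I x₀).right_inv hy] at hsymm
  rw [Trivialization.localFrame_apply_of_mem_baseSet _ _ hbase, chartFrame, ← hsymm,
    ← coe_toBasis_basisFun_eq_stdFrame]
  exact (Module.Basis.map_apply _ _ _).trans (Trivialization.symmL_apply (hb := hbase) ..).symm

theorem contMDiff_iff_contDiffOn_extChartAt_symm [IsManifold I ∞ M] {f : M → ℝ} :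
    ContMDiff I 𝓘(ℝ) ∞ f ↔
      ∀ x₀ : M, ContDiffOn ℝ ∞ (f ∘ (extChartAt I x₀).symm) (extChartAt I x₀).target := by
  refine ⟨fun hf x₀ => contMDiffOn_iff_contDiffOn.1 (hf.comp_contMDiffOn
    (contMDiffOn_extChartAt_symm x₀)), fun hf x₀ => ?_⟩
  have hcomp : ContMDiffOn I 𝓘(ℝ) ∞ ((f ∘ (extChartAt I x₀).symm) ∘ extChartAt I x₀)
      (chartAt H x₀).source :=
    (hf x₀).contMDiffOn.comp contMDiffOn_extChartAt fun x hx =>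
      (extChartAt I x₀).map_source (by rwa [extChartAt_source])
  refine (hcomp.congr fun x hx => ?_).contMDiffAt (chart_source_mem_nhds H x₀)
  exact (congrArg f ((extChartAt I x₀).left_inv (by rwa [extChartAt_source]))).symm

theorem IsSmoothForm.add {k : ℕ} {η θ : DiffForm I M k}
    (hη : IsSmoothForm η) (hθ : IsSmoothForm θ) : IsSmoothForm (η + θ) :=
  fun x₀ v => (hη x₀ v).add (hθ x₀ v)

theorem IsSmoothForm.const_smul {k : ℕ} (c : ℝ) {η : DiffForm I M k} (hη : IsSmoothForm η) :
    IsSmoothForm (c • η) :=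
  fun x₀ v => (hη x₀ v).const_smul c

theorem IsSmoothForm.sub {k : ℕ} {η θ : DiffForm I M k}
    (hη : IsSmoothForm η) (hθ : IsSmoothForm θ) : IsSmoothForm (η - θ) :=
  fun x₀ v => (hη x₀ v).sub (hθ x₀ v)

theorem IsSmoothForm.smul [IsManifold I ∞ M] {k : ℕ} {f : M → ℝ} {η : DiffForm I M k}
    (hf : ContMDiff I 𝓘(ℝ) ∞ f) (hη : IsSmoothForm η) : IsSmoothForm fun x => f x • η x :=
  fun x₀ v => (contMDiff_iff_contDiffOn_extChartAt_symm.1 hf x₀).mul (hη x₀ v)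

theorem isSmoothForm_zero_iff {f : DiffForm I M 0} [IsManifold I ∞ M] :
    IsSmoothForm f ↔ ContMDiff I 𝓘(ℝ) ∞ fun x => f x Fin.elim0 := by
  rw [contMDiff_iff_contDiffOn_extChartAt_symm]
  refine forall_congr' fun x₀ => ?_
  have happly (v : Fin 0 → EuclideanSpace ℝ (Fin n)) (y : EuclideanSpace ℝ (Fin n)) :
      chartPullback x₀ f y v = f ((extChartAt I x₀).symm y) Fin.elim0 :=
    congrArg (f ((extChartAt I x₀).symm y)) (Subsingleton.elim _ _)
  simp only [happly, forall_const]
  rfl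

end Charts

section Matrices

variable {E : Type*} [NormedAddCommGroup E] [NormedSpace ℝ E] {ι : Type*} [Fintype ι]
  [DecidableEq ι] {A : E → Matrix ι ι ℝ} {s : Set E} {m : WithTop ℕ∞}

theorem contDiffOn_matrix_det (hA : ∀ i j, ContDiffOn ℝ m (fun y => A y i j) s) :
    ContDiffOn ℝ m (fun y => (A y).det) s := by
  simp only [Matrix.det_apply']
  exact ContDiffOn.sum fun σ _ => contDiffOn_const.mul (contDiffOn_prod fun i _ => hA _ _)

theorem contDiffOn_matrix_inv (hA : ∀ i j, ContDiffOn ℝ m (fun y => A y i j) s)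
    (hdet : ∀ y ∈ s, (A y).det ≠ 0) (i j : ι) : ContDiffOn ℝ m (fun y => (A y)⁻¹ i j) s := by
  simp only [Matrix.inv_def, Matrix.smul_apply, Ring.inverse_eq_inv', smul_eq_mul,
    Matrix.adjugate_apply]
  refine ((contDiffOn_matrix_det hA).inv hdet).mul (contDiffOn_matrix_det fun p q => ?_)
  simp only [Matrix.updateRow_apply]
  split_ifs
  · exact contDiffOn_const
  · exact hA p q

end Matrices

section Metric

variable {n : ℕ} {H : Type*} [TopologicalSpace H]
  {I : ModelWithCorners ℝ (EuclideanSpace ℝ (Fin n)) H}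
  {M : Type*} [TopologicalSpace M] [ChartedSpace H M]
  [RiemannianBundle (fun x : M => TangentSpace I x)]

theorem det_gram_chartFrame_pos [IsManifold I 1 M] {x₀ : M} {y : EuclideanSpace ℝ (Fin n)}
    (hy : y ∈ (extChartAt I x₀).target) : 0 < (Matrix.gram ℝ (chartFrame I x₀ y)).det := by
  obtain ⟨v, hv⟩ := exists_basis_chartFrame hy
  rw [← hv]
  exact (Matrix.posDef_gram_iff_linearIndependent.2 v.linearIndependent).det_pos

variable [IsManifold I ∞ M]
  [IsContMDiffRiemannianBundle I ∞ (EuclideanSpace ℝ (Fin n)) (fun x : M => TangentSpace I x)]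

theorem contDiffOn_gram_chartFrame (x₀ : M) (i j : Fin n) :
    ContDiffOn ℝ ∞ (fun y => Matrix.gram ℝ (chartFrame I x₀ y) i j) (extChartAt I x₀).target := by
  let e := trivializationAt (EuclideanSpace ℝ (Fin n)) (TangentSpace I) x₀
  have hframe := fun i => e.contMDiffOn_localFrame_baseSet (I := I) (n := ∞)
    (EuclideanSpace.basisFun (Fin n) ℝ).toBasis i
  have hinner := ((hframe i).inner_bundle (hframe j)).comp
    (contMDiffOn_extChartAt_symm (I := I) (n := ∞) x₀)
    fun y hy => by simpa [e] using symm_mem_chartAt_source hy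
  refine (contMDiffOn_iff_contDiffOn.1 hinner).congr fun y hy => ?_
  simp only [Matrix.gram_apply, Function.comp_apply, e, localFrame_eq_chartFrame hy]

theorem contDiffOn_sqrt_det_gram_chartFrame (x₀ : M) :
    ContDiffOn ℝ ∞ (fun y => √(Matrix.gram ℝ (chartFrame I x₀ y)).det) (extChartAt I x₀).target :=
  (contDiffOn_matrix_det (contDiffOn_gram_chartFrame x₀)).sqrt fun _ hy =>
    (det_gram_chartFrame_pos hy).ne'

theorem contDiffOn_formInner {k : ℕ} (x₀ : M)
    {a b : ∀ y, TangentSpace I ((extChartAt I x₀).symm y) [⋀^Fin k]→ₗ[ℝ] ℝ}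
    (ha : ∀ f : Fin k → Fin n,
      ContDiffOn ℝ ∞ (fun y => a y (chartFrame I x₀ y ∘ f)) (extChartAt I x₀).target)
    (hb : ∀ f : Fin k → Fin n,
      ContDiffOn ℝ ∞ (fun y => b y (chartFrame I x₀ y ∘ f)) (extChartAt I x₀).target) :
    ContDiffOn ℝ ∞ (fun y => formInner (a y) (b y)) (extChartAt I x₀).target := by
  have hexpansion : ContDiffOn ℝ ∞ (fun y => (k.factorial : ℝ)⁻¹ *
      ∑ f : Fin k → Fin n, ∑ g : Fin k → Fin n,
        (∏ i, (Matrix.gram ℝ (chartFrame I x₀ y))⁻¹ (f i) (g i)) *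
          (a y (chartFrame I x₀ y ∘ f) * b y (chartFrame I x₀ y ∘ g))) (extChartAt I x₀).target :=
    contDiffOn_const.mul <| ContDiffOn.sum fun f _ => ContDiffOn.sum fun g _ =>
      (contDiffOn_prod fun i _ => contDiffOn_matrix_inv (contDiffOn_gram_chartFrame x₀)
        (fun _ hy => (det_gram_chartFrame_pos hy).ne') _ _).mul ((ha f).mul (hb g))
  refine hexpansion.congr fun y hy => ?_
  obtain ⟨v, hv⟩ := exists_basis_chartFrame hy
  simp only [← hv]
  exact formInner_eq_sum_basis v (a y) (b y)

theorem IsSmoothForm.contMDiff_formInner {k : ℕ} {η θ : DiffForm I M k} (hη : IsSmoothForm η)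
    (hθ : IsSmoothForm θ) : ContMDiff I 𝓘(ℝ) ∞ fun x => formInner (η x) (θ x) :=
  contMDiff_iff_contDiffOn_extChartAt_symm.2 fun x₀ =>
    contDiffOn_formInner x₀ (fun f => hη x₀ (stdFrame n ∘ f)) fun f => hθ x₀ (stdFrame n ∘ f)

end Metric

section VolForm

variable {n : ℕ} {H : Type*} [TopologicalSpace H]
  {I : ModelWithCorners ℝ (EuclideanSpace ℝ (Fin n)) H}
  {M : Type*} [TopologicalSpace M] [ChartedSpace H M]

theorem contDiffOn_of_continuousOn_of_eq_one_or_neg_one {E : Type*} [NormedAddCommGroup E]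
    [NormedSpace ℝ E] {f : E → ℝ} {s : Set E} {m : WithTop ℕ∞} (hf : ContinuousOn f s)
    (hpm : ∀ y ∈ s, f y = 1 ∨ f y = -1) : ContDiffOn ℝ m f s := by
  intro y hy
  refine (contDiffWithinAt_const (c := f y)).congr_of_eventuallyEq ?_ rfl
  filter_upwards [(hf y hy).eventually (Metric.ball_mem_nhds (f y) one_pos), self_mem_nhdsWithin]
    with z hz hzs
  rw [Real.dist_eq, abs_lt] at hz
  rcases hpm y hy with h | h <;> rcases hpm z hzs with h' | h' <;> rw [h, h'] at hz ⊢ <;> linarith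

variable [RiemannianBundle (fun x : M => TangentSpace I x)] (o : ManifoldOrientation I M)

/-- The Riemannian volume form. -/
noncomputable def volForm : DiffForm I M n :=
  fun x => (o.orient x).volumeForm

theorem chartSign_eq_sign_volForm (x₀ : M) (y : EuclideanSpace ℝ (Fin n)) :
    chartSign o.orient x₀ y = SignType.sign (chartPullback x₀ (volForm o) y (stdFrame n)) := by
  obtain ⟨c, hc, h⟩ := exists_someVector_eq_smul_volumeForm
    (o.orient ((extChartAt I x₀).symm y))
  change ((SignType.sign ((o.orient ((extChartAt I x₀).symm y)).someVector
    (chartFrame I x₀ y)) : SignType) : ℝ) = SignType.sign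
      ((o.orient ((extChartAt I x₀).symm y)).volumeForm (chartFrame I x₀ y))
  rw [h, AlternatingMap.smul_apply, smul_eq_mul, sign_mul, sign_pos hc, one_mul]

theorem chartSign_mul_chartPullback_volForm (x₀ : M) (y : EuclideanSpace ℝ (Fin n)) :
    chartSign o.orient x₀ y * chartPullback x₀ (volForm o) y (stdFrame n) =
      √(Matrix.gram ℝ (chartFrame I x₀ y)).det := by
  have hsq : chartPullback x₀ (volForm o) y (stdFrame n) ^ 2 =
      (Matrix.gram ℝ (chartFrame I x₀ y)).det :=
    volumeForm_sq (o.orient ((extChartAt I x₀).symm y)) (chartFrame I x₀ y)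
  rw [chartSign_eq_sign_volForm, ← hsq, Real.sqrt_sq_eq_abs, sign_mul_self]

theorem chartSign_eq_one_or_neg_one [IsManifold I 1 M] {x₀ : M} {y : EuclideanSpace ℝ (Fin n)}
    (hy : y ∈ (extChartAt I x₀).target) :
    chartSign o.orient x₀ y = 1 ∨ chartSign o.orient x₀ y = -1 := by
  have hne : chartPullback x₀ (volForm o) y (stdFrame n) ≠ 0 := by
    refine right_ne_zero_of_mul (a := chartSign o.orient x₀ y) ?_
    rw [chartSign_mul_chartPullback_volForm]
    exact (Real.sqrt_pos.2 (det_gram_chartFrame_pos hy)).ne'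
  rw [chartSign_eq_sign_volForm]
  rcases hne.lt_or_gt with h | h
  · exact Or.inr (by rw [sign_neg h, SignType.coe_neg_one])
  · exact Or.inl (by rw [sign_pos h, SignType.coe_one])

variable [IsManifold I ∞ M]
  [IsContMDiffRiemannianBundle I ∞ (EuclideanSpace ℝ (Fin n)) (fun x : M => TangentSpace I x)]

theorem isSmoothForm_volForm : IsSmoothForm (volForm o) := by
  intro x₀ v
  have hframe : ContDiffOn ℝ ∞ (fun y => chartPullback x₀ (volForm o) y (stdFrame n))
      (extChartAt I x₀).target := by
    have hsign := contDiffOn_of_continuousOn_of_eq_one_or_neg_one (m := ∞)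
      (o.continuousOn_chartSign x₀) fun y hy => chartSign_eq_one_or_neg_one o hy
    refine (hsign.mul (contDiffOn_sqrt_det_gram_chartFrame x₀)).congr fun y hy => ?_
    rw [← chartSign_mul_chartPullback_volForm o]
    rcases chartSign_eq_one_or_neg_one o hy with h | h <;> rw [h] <;> ring
  refine (hframe.mul (contDiffOn_const
    (c := (EuclideanSpace.basisFun (Fin n) ℝ).toBasis.det v))).congr fun y _ => ?_
  have hdet := (chartPullback x₀ (volForm o) y).eq_smul_basis_det
    (EuclideanSpace.basisFun (Fin n) ℝ).toBasis
  rw [coe_toBasis_basisFun_eq_stdFrame] at hdet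
  exact congrArg (fun η => η v) hdet

variable {o}

theorem IsSmoothForm.hodgeStar {k l : ℕ} (h : k + l = n) {η : DiffForm I M k}
    (hη : IsSmoothForm η) : IsSmoothForm (hodgeStar o h η) := by
  intro x₀ w
  have h' : l + k = n := (add_comm l k).trans h
  let D (y : EuclideanSpace ℝ (Fin n)) := mfderivWithin 𝓘(ℝ, EuclideanSpace ℝ (Fin n)) I
    (extChartAt I x₀).symm (range I) y
  have hinsert (f : Fin k → Fin n) : ContDiffOn ℝ ∞
      (fun y => insertLeft h' (volForm o ((extChartAt I x₀).symm y)) (D y ∘ w)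
        (chartFrame I x₀ y ∘ f)) (extChartAt I x₀).target :=
    (isSmoothForm_volForm o x₀ (concat h' w (stdFrame n ∘ f))).congr fun y _ =>
      congrArg (volForm o _) (concat_comp h' (D y) w (stdFrame n ∘ f))
  exact (contDiffOn_const.mul (contDiffOn_formInner x₀ (fun f => hη x₀ (stdFrame n ∘ f))
    hinsert)).congr fun y _ => hodge_apply _ h h' _ (D y ∘ w)

theorem IsSmoothForm.contMDiff_density {μ : DiffForm I M n} (hμ : IsSmoothForm μ) :
    ContMDiff I 𝓘(ℝ) ∞ (density o μ) :=
  isSmoothForm_zero_iff.1 (hμ.hodgeStar (Nat.add_zero n))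

end VolForm

section RiemannianMeasure

variable {n : ℕ} {H : Type*} [TopologicalSpace H]
  {I : ModelWithCorners ℝ (EuclideanSpace ℝ (Fin n)) H}
  {M : Type*} [TopologicalSpace M] [ChartedSpace H M]

theorem measurableSet_extChartAt_target (x₀ : M) : MeasurableSet (extChartAt I x₀).target := by
  rw [extChartAt_target]
  exact ((chartAt H x₀).open_target.preimage I.continuous_symm).measurableSet.inter
    I.isClosed_range.measurableSet

theorem volume_inter_extChartAt_target_pos (x₀ : M) {U : Set (EuclideanSpace ℝ (Fin n))}
    (hU : IsOpen U) (h : (U ∩ (extChartAt I x₀).target).Nonempty) :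
    0 < volume (U ∩ (extChartAt I x₀).target) := by
  obtain ⟨y, hyU, hy⟩ := h
  rw [extChartAt_target] at hy ⊢
  have hW : IsOpen (U ∩ I.symm ⁻¹' (chartAt H x₀).target) :=
    hU.inter ((chartAt H x₀).open_target.preimage I.continuous_symm)
  obtain ⟨z, hz, hzi⟩ :=
    mem_closure_iff.1 (I.range_subset_closure_interior hy.2) _ hW ⟨hyU, hy.1⟩
  refine ((hW.inter isOpen_interior).measure_pos volume ⟨z, hz, hzi⟩).trans_le (measure_mono ?_)
  rintro w ⟨⟨hwU, hwt⟩, hwi⟩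
  exact ⟨hwU, hwt, interior_subset hwi⟩

theorem aemeasurable_extChartAt_symm [MeasurableSpace M] [BorelSpace M] (x₀ : M) :
    AEMeasurable (extChartAt I x₀).symm (volume.restrict (extChartAt I x₀).target) :=
  (continuousOn_extChartAt_symm x₀).aemeasurable (measurableSet_extChartAt_target x₀)

variable [IsManifold I ∞ M] [CompactSpace M] [T2Space M]

theorem finite_partitionOfUnity_ne_zero : {x₀ : M | partitionOfUnity I M x₀ ≠ 0}.Finite := by
  refine (partitionOfUnity I M).locallyFinite.finite_nonempty_of_compact.subset fun x₀ hx => ?_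
  by_contra hne
  rw [mem_ofPred_eq, not_nonempty_iff_eq_empty, Function.support_eq_empty_iff] at hne
  exact hx (ContMDiffMap.ext fun x => congrFun hne x)

theorem tsupport_partitionOfUnity_subset (x₀ : M) :
    tsupport (partitionOfUnity I M x₀) ⊆ (extChartAt I x₀).source := by
  rw [extChartAt_source]
  exact (SmoothPartitionOfUnity.exists_isSubordinate_chartAt_source I M).choose_spec x₀

theorem continuousOn_partitionOfUnity_extChartAt_symm (x₀ : M) :
    ContinuousOn (fun y => partitionOfUnity I M x₀ ((extChartAt I x₀).symm y))
      (extChartAt I x₀).target :=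
  (partitionOfUnity I M x₀).contMDiff.continuous.comp_continuousOn
    (continuousOn_extChartAt_symm x₀)

theorem integrableOn_partitionOfUnity_mul (x₀ : M) {g : EuclideanSpace ℝ (Fin n) → ℝ}
    (hg : ContinuousOn g (extChartAt I x₀).target) :
    IntegrableOn (fun y => partitionOfUnity I M x₀ ((extChartAt I x₀).symm y) * g y)
      (extChartAt I x₀).target := by
  set K := extChartAt I x₀ '' tsupport (partitionOfUnity I M x₀)
  have hsource := tsupport_partitionOfUnity_subset (I := I) x₀
  have hK : IsCompact K := (isClosed_tsupport _).isCompact.image_of_continuousOn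
    ((continuousOn_extChartAt x₀).mono hsource)
  have hKt : K ⊆ (extChartAt I x₀).target :=
    (image_mono hsource).trans (extChartAt I x₀).mapsTo.image_subset
  have hcont : ContinuousOn
      (fun y => partitionOfUnity I M x₀ ((extChartAt I x₀).symm y) * g y)
      (extChartAt I x₀).target :=
    (continuousOn_partitionOfUnity_extChartAt_symm x₀).mul hg
  refine ((hcont.mono hKt).integrableOn_compact hK).of_forall_sdiff_eq_zero
    (measurableSet_extChartAt_target x₀) fun y hy => ?_
  have hnotMem : (extChartAt I x₀).symm y ∉ tsupport (partitionOfUnity I M x₀) := fun h =>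
    hy.2 ⟨_, h, (extChartAt I x₀).right_inv hy.1⟩
  rw [image_eq_zero_of_notMem_tsupport hnotMem, zero_mul]

variable [RiemannianBundle (fun x : M => TangentSpace I x)]

/-- The expression in the chart around `x₀` of the density of the Riemannian measure, cut off by
the function of index `x₀` of the partition of unity. -/
noncomputable def chartDensity (I : ModelWithCorners ℝ (EuclideanSpace ℝ (Fin n)) H)
    [IsManifold I ∞ M] [RiemannianBundle (fun x : M => TangentSpace I x)] (x₀ : M)
    (y : EuclideanSpace ℝ (Fin n)) : ℝ :=
  partitionOfUnity I M x₀ ((extChartAt I x₀).symm y) * √(Matrix.gram ℝ (chartFrame I x₀ y)).det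

theorem chartDensity_nonneg (x₀ : M) (y : EuclideanSpace ℝ (Fin n)) : 0 ≤ chartDensity I x₀ y :=
  mul_nonneg ((partitionOfUnity I M).nonneg _ _) (Real.sqrt_nonneg _)

theorem integrableOn_chartDensity
    [IsContMDiffRiemannianBundle I ∞ (EuclideanSpace ℝ (Fin n)) (fun x : M => TangentSpace I x)]
    (x₀ : M) : IntegrableOn (chartDensity I x₀) (extChartAt I x₀).target :=
  integrableOn_partitionOfUnity_mul x₀ (contDiffOn_sqrt_det_gram_chartFrame x₀).continuousOn

variable [MeasurableSpace M]

/-- The part of the Riemannian measure carried by the function of index `x₀` of the partition of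
unity: the image under the inverse chart of the measure with density `chartDensity I x₀`. -/
noncomputable def chartMeasure (I : ModelWithCorners ℝ (EuclideanSpace ℝ (Fin n)) H)
    [IsManifold I ∞ M] [RiemannianBundle (fun x : M => TangentSpace I x)] (x₀ : M) : Measure M :=
  ((volume.restrict (extChartAt I x₀).target).withDensity
    fun y => ENNReal.ofReal (chartDensity I x₀ y)).map (extChartAt I x₀).symm

variable (I M) in
/-- The Riemannian measure of a compact Riemannian manifold, glued from its expressions
`√(det g) dy` in charts by a partition of unity. -/
noncomputable def riemannianMeasure : Measure M :=
  ∑ x₀ ∈ (finite_partitionOfUnity_ne_zero (I := I) (M := M)).toFinset, chartMeasure I x₀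

variable [BorelSpace M]

theorem aemeasurable_extChartAt_symm_withDensity (x₀ : M) :
    AEMeasurable (extChartAt I x₀).symm ((volume.restrict (extChartAt I x₀).target).withDensity
      fun y => ENNReal.ofReal (chartDensity I x₀ y)) :=
  (aemeasurable_extChartAt_symm x₀).mono_ac (withDensity_absolutelyContinuous _ _)

variable
  [IsContMDiffRiemannianBundle I ∞ (EuclideanSpace ℝ (Fin n)) (fun x : M => TangentSpace I x)]

instance isFiniteMeasure_chartMeasure (x₀ : M) : IsFiniteMeasure (chartMeasure I x₀) := by
  have := isFiniteMeasure_withDensity_ofReal (integrableOn_chartDensity (I := I) x₀).2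
  rw [chartMeasure]
  infer_instance

instance isFiniteMeasure_riemannianMeasure : IsFiniteMeasure (riemannianMeasure I M) := by
  rw [riemannianMeasure]
  infer_instance

theorem integral_chartMeasure (x₀ : M) {f : M → ℝ} (hf : Continuous f) :
    ∫ x, f x ∂chartMeasure I x₀ =
      ∫ y in (extChartAt I x₀).target, chartDensity I x₀ y * f ((extChartAt I x₀).symm y) := by
  rw [chartMeasure, integral_map (aemeasurable_extChartAt_symm_withDensity x₀)
    hf.aestronglyMeasurable, integral_withDensity_eq_integral_toReal_smul₀
      (integrableOn_chartDensity x₀).aemeasurable.ennreal_ofReal (by simp)]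
  simp only [ENNReal.toReal_ofReal (chartDensity_nonneg _ _), smul_eq_mul]

theorem chartMeasure_ne_zero {x₀ : M} {U : Set M} (hU : IsOpen U)
    (h : (U ∩ Function.support (partitionOfUnity I M x₀)).Nonempty) :
    chartMeasure I x₀ U ≠ 0 := by
  obtain ⟨x, hxU, hx⟩ := h
  set e := extChartAt I x₀
  have hxs : x ∈ e.source := tsupport_partitionOfUnity_subset x₀ (subset_tsupport _ hx)
  have hsupp : IsOpen (Function.support (partitionOfUnity I M x₀)) :=
    (partitionOfUnity I M x₀).contMDiff.continuous.isOpen_support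
  obtain ⟨W, hW, hWeq⟩ := continuousOn_iff'.1 (continuousOn_extChartAt_symm (I := I) x₀)
    (U ∩ Function.support (partitionOfUnity I M x₀)) (hU.inter hsupp)
  have hxW : e x ∈ W ∩ e.target := by
    rw [← hWeq, mem_inter_iff, mem_preimage, e.left_inv hxs]
    exact ⟨⟨hxU, hx⟩, e.map_source hxs⟩
  rw [chartMeasure, Measure.map_apply_of_aemeasurable (aemeasurable_extChartAt_symm_withDensity x₀)
    hU.measurableSet, Ne, withDensity_apply_eq_zero'
      (integrableOn_chartDensity x₀).aemeasurable.ennreal_ofReal]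
  refine (((volume_inter_extChartAt_target_pos x₀ hW ⟨_, hxW⟩).trans_le (measure_mono ?_)).trans_le
    (Measure.le_restrict_apply _ _)).ne'
  intro y hy
  rw [← hWeq] at hy
  obtain ⟨⟨hyU, hyρ⟩, hyt⟩ := hy
  refine ⟨⟨(ENNReal.ofReal_pos.2 (mul_pos ?_ ?_)).ne', hyU⟩, hyt⟩
  · exact ((partitionOfUnity I M).nonneg _ _).lt_of_ne' hyρ
  · exact Real.sqrt_pos.2 (det_gram_chartFrame_pos hyt)

instance isOpenPosMeasure_riemannianMeasure : (riemannianMeasure I M).IsOpenPosMeasure where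
  open_pos U hU := by
    rintro ⟨x, hx⟩
    obtain ⟨x₀, hx₀⟩ := (partitionOfUnity I M).exists_pos_of_mem (mem_univ x)
    have hmem : x₀ ∈ (finite_partitionOfUnity_ne_zero (I := I) (M := M)).toFinset := by
      rw [Finite.mem_toFinset]
      exact fun h => hx₀.ne' (by rw [h]; rfl)
    have hle : chartMeasure I x₀ ≤ riemannianMeasure I M :=
      Finset.single_le_sum (f := chartMeasure I) (fun _ _ => Measure.zero_le _) hmem
    exact ((chartMeasure_ne_zero hU ⟨x, hx, hx₀.ne'⟩).bot_lt.trans_le (hle U)).ne'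

theorem formIntegral_smul_volForm (o : ManifoldOrientation I M) {f : M → ℝ} (hf : Continuous f) :
    (formIntegral o fun x => f x • volForm o x) = ∫ x, f x ∂riemannianMeasure I M := by
  rw [formIntegral, riemannianMeasure, integral_finsetSum_measure fun x₀ _ =>
    hf.integrable_of_hasCompactSupport (HasCompactSupport.of_compactSpace f),
    finsum_eq_sum_of_support_subset
      (s := (finite_partitionOfUnity_ne_zero (I := I) (M := M)).toFinset)]
  · refine Finset.sum_congr rfl fun x₀ _ => ?_
    rw [integral_chartMeasure x₀ hf]
    congr 1
    funext y
    rw [chartDensity, ← chartSign_mul_chartPullback_volForm o]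
    change _ * _ * (f _ * chartPullback x₀ (volForm o) y (stdFrame n)) = _
    ring
  · intro x₀ hx
    rw [Finite.coe_toFinset]
    intro h
    exact hx (by simp [h])

theorem eq_zero_of_integral_riemannianMeasure_eq_zero {f : M → ℝ} (hf : Continuous f)
    (hnonneg : 0 ≤ f) (h : ∫ x, f x ∂riemannianMeasure I M = 0) : f = 0 := by
  rw [integral_eq_zero_iff_of_nonneg hnonneg
    (hf.integrable_of_hasCompactSupport (HasCompactSupport.of_compactSpace f))] at h
  exact (hf.ae_eq_iff_eq _ continuous_const).1 h

end RiemannianMeasure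

section ParametricIntegral

variable {X : Type*} [TopologicalSpace X] [CompactSpace X] [MeasurableSpace X]
  [OpensMeasurableSpace X] {ν : Measure X} [IsFiniteMeasure ν]

theorem hasDerivAt_integral_of_continuousOn {F F' : ℝ → X → ℝ} {s : Set ℝ} {t : ℝ}
    (hs : s ∈ nhds t) (hF : ∀ ε ∈ s, Continuous (F ε))
    (hF' : ContinuousOn (Function.uncurry F') (s ×ˢ univ))
    (hderiv : ∀ ε ∈ s, ∀ x, HasDerivAt (fun ε => F ε x) (F' ε x) ε) :
    HasDerivAt (fun ε => ∫ x, F ε x ∂ν) (∫ x, F' t x ∂ν) t := by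
  obtain ⟨K, hKt, hKs, hK⟩ := local_compact_nhds hs
  obtain ⟨C, hC⟩ := (hK.prod isCompact_univ).exists_bound_of_continuousOn
    (hF'.mono (prod_mono_left hKs))
  have hF't : Continuous (F' t) :=
    hF'.comp_continuous (by fun_prop : Continuous fun x => (t, x))
      fun x => ⟨mem_of_mem_nhds hs, mem_univ x⟩
  exact (hasDerivAt_integral_of_dominated_loc_of_deriv_le (bound := fun _ => C) hKt
    (Filter.eventually_of_mem hs fun ε hε => (hF ε hε).aestronglyMeasurable)
    ((hF t (mem_of_mem_nhds hs)).integrable_of_hasCompactSupport (.of_compactSpace _))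
    hF't.aestronglyMeasurable
    (ae_of_all _ fun x ε hε => hC (ε, x) ⟨hε, mem_univ x⟩) (integrable_const C)
    (ae_of_all _ fun x ε hε => hderiv ε (hKs hε) x)).2

end ParametricIntegral

section Pairing

variable {k l n : ℕ}

theorem wedge_smul_left {V : Type*} [AddCommGroup V] [Module ℝ V] (h : k + l = n) (c : ℝ)
    (a : V [⋀^Fin k]→ₗ[ℝ] ℝ) (b : V [⋀^Fin l]→ₗ[ℝ] ℝ) : wedge h (c • a) b = c • wedge h a b := by
  simp only [wedge, ← AlternatingMap.domCoprod'_apply, ← TensorProduct.smul_tmul', map_smul]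
  ext
  simp

theorem wedge_smul_right {V : Type*} [AddCommGroup V] [Module ℝ V] (h : k + l = n) (c : ℝ)
    (a : V [⋀^Fin k]→ₗ[ℝ] ℝ) (b : V [⋀^Fin l]→ₗ[ℝ] ℝ) : wedge h a (c • b) = c • wedge h a b := by
  have h' : l + k = n := (add_comm l k).trans h
  rw [wedge_comm h' h, wedge_comm h' h, wedge_smul_left, smul_comm]

variable {H : Type*} [TopologicalSpace H]
  {I : ModelWithCorners ℝ (EuclideanSpace ℝ (Fin n)) H}
  {M : Type*} [TopologicalSpace M] [ChartedSpace H M] [IsManifold I ∞ M] [CompactSpace M]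
  [T2Space M] (o : ManifoldOrientation I M)

theorem formIntegral_smul (c : ℝ) (η : DiffForm I M n) :
    formIntegral o (c • η) = c * formIntegral o η := by
  rw [formIntegral, formIntegral, ← smul_eq_mul, smul_finsum]
  congr! 2 with x₀
  rw [smul_eq_mul, ← integral_const_mul]
  congr 1
  funext y
  change _ * _ * (c * chartPullback x₀ η y (stdFrame n)) = _
  ring

theorem pairing_smul_left (h : k + l = n) (c : ℝ) (a : DiffForm I M k) (b : DiffForm I M l) :
    pairing o h (c • a) b = c * pairing o h a b := by
  simp only [pairing, ← formIntegral_smul, Pi.smul_apply, wedge_smul_left, Pi.smul_def]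

theorem pairing_comm (h : k + l = n) (h' : l + k = n) (a : DiffForm I M k)
    (b : DiffForm I M l) : pairing o h' b a = (-1) ^ (k * l) * pairing o h a b := by
  simp only [pairing, ← formIntegral_smul, wedge_comm h h', Pi.smul_def]

theorem pairing_neg_one_pow_smul (h : k + l = n) (h' : l + k = n) (a : DiffForm I M k)
    (b : DiffForm I M l) : pairing o h' ((-1 : ℝ) ^ (k * l) • b) a = pairing o h a b := by
  rw [pairing_smul_left, pairing_comm o h h', ← mul_assoc, ← mul_pow, neg_one_mul, neg_neg,
    one_pow, one_mul]

end Pairing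

section WeightedHodgeStar

variable {k l n : ℕ} {H : Type*} [TopologicalSpace H]
  {I : ModelWithCorners ℝ (EuclideanSpace ℝ (Fin n)) H}
  {M : Type*} [TopologicalSpace M] [ChartedSpace H M]
  [RiemannianBundle (fun x : M => TangentSpace I x)] (o : ManifoldOrientation I M)

/-- The form `w *β`, which is the variational derivative at `β` of the kinetic energy with
weight `w`. -/
noncomputable def weightedHodgeStar (h : k + l = n) (w : M → ℝ) (β : DiffForm I M k) :
    DiffForm I M l :=
  fun x => w x • hodgeStar o h β x

theorem weightedHodgeStar_inv_smul_weightedHodgeStar (h : k + l = n) (h' : l + k = n) {w : M → ℝ}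
    (hw : ∀ x, w x ≠ 0) (β : DiffForm I M k) :
    weightedHodgeStar o h' w⁻¹ ((-1 : ℝ) ^ (k * l) • weightedHodgeStar o h w β) = β := by
  funext x
  change (w x)⁻¹ • hodgeₗ (o.orient x) h' ((-1 : ℝ) ^ (k * l) • w x • hodge (o.orient x) h (β x)) =
    _
  rw [map_smul, map_smul, hodgeₗ_apply, hodge_hodge, smul_comm, inv_smul_smul₀ (hw x), smul_smul,
    ← mul_pow, neg_one_mul, neg_neg, one_pow, one_smul]

theorem smul_weightedHodgeStar_weightedHodgeStar_inv (h : k + l = n) (h' : l + k = n) {w : M → ℝ}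
    (hw : ∀ x, w x ≠ 0) (α : DiffForm I M l) :
    (-1 : ℝ) ^ (k * l) • weightedHodgeStar o h w (weightedHodgeStar o h' w⁻¹ α) = α := by
  funext x
  change (-1 : ℝ) ^ (k * l) • w x • hodgeₗ (o.orient x) h ((w x)⁻¹ • hodge (o.orient x) h' (α x)) =
    _
  rw [map_smul, hodgeₗ_apply, hodge_hodge, smul_inv_smul₀ (hw x), smul_smul, mul_comm l k,
    ← mul_pow, neg_one_mul, neg_neg, one_pow, one_smul]

theorem momentum_eq_smul_weightedHodgeStar (hn : 1 ≤ n) (β : DiffForm I M (n - 1))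
    (μ : DiffForm I M n) :
    momentum hn o β μ = (-1 : ℝ) ^ ((n - 1) * 1) •
      weightedHodgeStar o (Nat.sub_add_cancel hn) (density o μ) β := by
  funext x
  rw [mul_one, momentum, mul_smul]
  rfl

theorem density_add_smul (μ δ : DiffForm I M n) (ε : ℝ) :
    density o (μ + ε • δ) = density o μ + ε • density o δ := by
  funext x
  change hodgeₗ (o.orient x) (Nat.add_zero n) (μ x + ε • δ x) Fin.elim0 = _
  rw [map_add, map_smul]
  rfl

variable [IsManifold I ∞ M]
  [IsContMDiffRiemannianBundle I ∞ (EuclideanSpace ℝ (Fin n)) (fun x : M => TangentSpace I x)]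

variable {o} in
theorem IsSmoothForm.weightedHodgeStar (h : k + l = n) {w : M → ℝ} (hw : ContMDiff I 𝓘(ℝ) ∞ w)
    {β : DiffForm I M k} (hβ : IsSmoothForm β) : IsSmoothForm (weightedHodgeStar o h w β) :=
  (hβ.hodgeStar h).smul hw

variable [CompactSpace M] [T2Space M]

theorem pairing_weightedHodgeStar [MeasurableSpace M] [BorelSpace M] (h : k + l = n) {w : M → ℝ}
    (hw : Continuous w) {α β : DiffForm I M k} (hα : IsSmoothForm α) (hβ : IsSmoothForm β) :
    pairing o h α (weightedHodgeStar o h w β) =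
      ∫ x, w x * formInner (α x) (β x) ∂riemannianMeasure I M := by
  have hcont : Continuous fun x => w x * formInner (α x) (β x) :=
    hw.mul (hα.contMDiff_formInner hβ).continuous
  rw [← formIntegral_smul_volForm o hcont, pairing]
  congr 1
  funext x
  rw [weightedHodgeStar, wedge_smul_right, hodgeStar, wedge_hodge, smul_smul, volForm]

theorem pairing_zero_left [MeasurableSpace M] [BorelSpace M] {f : DiffForm I M 0}
    {μ : DiffForm I M n} (hf : IsSmoothForm f) (hμ : IsSmoothForm μ) :
    pairing o (Nat.zero_add n) f μ =
      ∫ x, f x Fin.elim0 * density o μ x ∂riemannianMeasure I M := by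
  have hcont : Continuous fun x => f x Fin.elim0 * density o μ x :=
    (isSmoothForm_zero_iff.1 hf).continuous.mul (hμ.contMDiff_density (o := o)).continuous
  rw [← formIntegral_smul_volForm o hcont, pairing]
  congr 1
  funext x
  have hstar := hodge_hodge (o.orient x) (Nat.add_zero n) (Nat.zero_add n) (μ x)
  rw [mul_zero, pow_zero, one_smul] at hstar
  conv_lhs => rw [← hstar]
  rw [wedge_hodge, volForm, formInner_apply]
  simp [density, hodgeStar, Subsingleton.elim _ (Fin.elim0 : Fin 0 → TangentSpace I x)]

theorem eq_of_forall_pairing_eq (h : k + l = n) {d d' : DiffForm I M k} (hd : IsSmoothForm d)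
    (hd' : IsSmoothForm d')
    (hpairing : ∀ δ, IsSmoothForm δ → pairing o h d δ = pairing o h d' δ) : d = d' := by
  borelize M
  have hsub := hd.sub hd'
  have hint {θ : DiffForm I M k} (hθ : IsSmoothForm θ) :
      Integrable (fun x => formInner (θ x) ((d - d') x)) (riemannianMeasure I M) :=
    (hθ.contMDiff_formInner hsub).continuous.integrable_of_hasCompactSupport (.of_compactSpace _)
  have htest := hpairing _ (hsub.weightedHodgeStar (o := o) h contMDiff_const (w := 1))
  simp only [pairing_weightedHodgeStar o h continuous_one hd hsub,
    pairing_weightedHodgeStar o h continuous_one hd' hsub, Pi.one_apply, one_mul] at htest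
  have hzero : ∫ x, formInner ((d - d') x) ((d - d') x) ∂riemannianMeasure I M = 0 := by
    rw [← sub_eq_zero.2 htest, ← integral_sub (hint hd) (hint hd')]
    simp only [Pi.sub_apply, LinearMap.map_sub₂]
  funext x
  exact sub_eq_zero.1 (formInner_self_eq_zero.1 (congrFun
    (eq_zero_of_integral_riemannianMeasure_eq_zero (hsub.contMDiff_formInner hsub).continuous
      (fun x => formInner_self_nonneg _) hzero) x))

theorem isVariationalDeriv_pairing (h : l + k = n) {F : DiffForm I M k → ℝ} {η : DiffForm I M k}
    {d : DiffForm I M l} (hd : IsSmoothForm d) (hrep : RepresentsDeriv (pairing o h) F η d) :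
    IsVariationalDeriv (pairing o h) F η d :=
  ⟨hd, hrep, fun _ hd' hrep' => eq_of_forall_pairing_eq o h hd' hd fun δ hδ =>
    (hrep' δ hδ).unique (hrep δ hδ)⟩

theorem isVariationalDeriv_pairing_swap (h : k + l = n) {F : DiffForm I M k → ℝ}
    {η : DiffForm I M k} {d : DiffForm I M l} (hd : IsSmoothForm d)
    (hrep : RepresentsDeriv (fun d δ => pairing o h δ d) F η d) :
    IsVariationalDeriv (fun d δ => pairing o h δ d) F η d := by
  refine ⟨hd, hrep, fun d' hd' hrep' => ?_⟩
  refine eq_of_forall_pairing_eq o ((add_comm l k).trans h) hd' hd fun δ hδ => ?_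
  have hδd : pairing o h δ d' = pairing o h δ d := (hrep' δ hδ).unique (hrep δ hδ)
  rw [pairing_comm o h, pairing_comm o h, hδd]

end WeightedHodgeStar

section KineticEnergy

variable {k l n : ℕ} {H : Type*} [TopologicalSpace H]
  {I : ModelWithCorners ℝ (EuclideanSpace ℝ (Fin n)) H}
  {M : Type*} [TopologicalSpace M] [ChartedSpace H M] [IsManifold I ∞ M] [CompactSpace M]
  [T2Space M] [RiemannianBundle (fun x : M => TangentSpace I x)] (o : ManifoldOrientation I M)

/-- The quadratic functional `β ↦ ∫ ½ w β ∧ *β`. The reduced Lagrangian is the case `w = *μ` in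
degree `n - 1`, the Hamiltonian the case `w = 1 / *μ` in degree `1`. -/
noncomputable def kineticEnergy (h : k + l = n) (w : M → ℝ) (β : DiffForm I M k) : ℝ :=
  1 / 2 * pairing o h β (weightedHodgeStar o h w β)

theorem kineticEnergy_eq_formIntegral (h : k + l = n) (w : M → ℝ) (β : DiffForm I M k) :
    kineticEnergy o h w β =
      formIntegral o fun x => (1 / 2 * w x) • wedge h (β x) (hodgeStar o h β x) := by
  rw [kineticEnergy, pairing, ← formIntegral_smul]
  simp only [weightedHodgeStar, wedge_smul_right, Pi.smul_def, smul_smul]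

theorem lagrangian_eq_kineticEnergy (hn : 1 ≤ n) (β : DiffForm I M (n - 1)) (μ : DiffForm I M n) :
    lagrangian hn o β μ = kineticEnergy o (Nat.sub_add_cancel hn) (density o μ) β :=
  (kineticEnergy_eq_formIntegral ..).symm

theorem hamiltonian_eq_kineticEnergy (hn : 1 ≤ n) (α : DiffForm I M 1) (μ : DiffForm I M n) :
    hamiltonian hn o α μ = kineticEnergy o (Nat.add_sub_of_le hn) (density o μ)⁻¹ α := by
  simp only [kineticEnergy_eq_formIntegral, hamiltonian, Pi.inv_apply, one_div, mul_inv]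

variable [IsContMDiffRiemannianBundle I ∞ (EuclideanSpace ℝ (Fin n))
  (fun x : M => TangentSpace I x)]

theorem kineticEnergy_add_smul (h : k + l = n) {w : M → ℝ} (hw : Continuous w)
    {β δ : DiffForm I M k} (hβ : IsSmoothForm β) (hδ : IsSmoothForm δ) (ε : ℝ) :
    kineticEnergy o h w (β + ε • δ) = kineticEnergy o h w β +
      ε * pairing o h δ (weightedHodgeStar o h w β) + ε ^ 2 * kineticEnergy o h w δ := by
  borelize M
  have hline : IsSmoothForm (β + ε • δ) := hβ.add (hδ.const_smul ε)
  have hexpand (x : M) : w x * formInner ((β + ε • δ) x) ((β + ε • δ) x) =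
      w x * formInner (β x) (β x) + 2 * ε * (w x * formInner (δ x) (β x)) +
        ε ^ 2 * (w x * formInner (δ x) (δ x)) := by
    simp only [Pi.add_apply, Pi.smul_apply, map_add, map_smul, LinearMap.add_apply,
      LinearMap.smul_apply, smul_eq_mul, formInner_comm (β x) (δ x)]
    ring
  have hint {θ η : DiffForm I M k} (hθ : IsSmoothForm θ) (hη : IsSmoothForm η) :
      Integrable (fun x => w x * formInner (θ x) (η x)) (riemannianMeasure I M) :=
    (hw.mul (hθ.contMDiff_formInner hη).continuous).integrable_of_hasCompactSupport
      (.of_compactSpace _)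
  simp only [kineticEnergy, pairing_weightedHodgeStar o h hw hline hline,
    pairing_weightedHodgeStar o h hw hβ hβ, pairing_weightedHodgeStar o h hw hδ hβ,
    pairing_weightedHodgeStar o h hw hδ hδ, hexpand]
  rw [integral_add (by exact (hint hβ hβ).add ((hint hδ hβ).const_mul _))
      ((hint hδ hδ).const_mul _), integral_add (hint hβ hβ) ((hint hδ hβ).const_mul _),
    integral_const_mul, integral_const_mul]
  ring

theorem representsDeriv_kineticEnergy (h : k + l = n) {w : M → ℝ} (hw : Continuous w)
    {β : DiffForm I M k} (hβ : IsSmoothForm β) :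
    RepresentsDeriv (fun d δ => pairing o h δ d) (kineticEnergy o h w) β
      (weightedHodgeStar o h w β) := by
  intro δ hδ
  simp only [kineticEnergy_add_smul o h hw hβ hδ]
  simpa using (((hasDerivAt_id (0 : ℝ)).mul_const
    (pairing o h δ (weightedHodgeStar o h w β))).const_add (kineticEnergy o h w β)).fun_add
    ((hasDerivAt_pow 2 (0 : ℝ)).mul_const (kineticEnergy o h w δ))

theorem isVariationalDeriv_kineticEnergy_swap (h : k + l = n) {w : M → ℝ}
    (hw : ContMDiff I 𝓘(ℝ) ∞ w) {β : DiffForm I M k} (hβ : IsSmoothForm β) :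
    IsVariationalDeriv (fun d δ => pairing o h δ d) (kineticEnergy o h w) β
      (weightedHodgeStar o h w β) :=
  isVariationalDeriv_pairing_swap o h (hβ.weightedHodgeStar h hw)
    (representsDeriv_kineticEnergy o h hw.continuous hβ)

theorem isVariationalDeriv_kineticEnergy (h : k + l = n) (h' : l + k = n) {w : M → ℝ}
    (hw : ContMDiff I 𝓘(ℝ) ∞ w) {β : DiffForm I M k} (hβ : IsSmoothForm β) :
    IsVariationalDeriv (pairing o h') (kineticEnergy o h w) β
      ((-1 : ℝ) ^ (k * l) • weightedHodgeStar o h w β) := by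
  refine isVariationalDeriv_pairing o h' ((hβ.weightedHodgeStar h hw).const_smul _) fun δ hδ => ?_
  rw [pairing_neg_one_pow_smul o h]
  exact representsDeriv_kineticEnergy o h hw.continuous hβ δ hδ

theorem isLegendreTransform_kineticEnergy (h : k + l = n) (h' : l + k = n) {w : M → ℝ}
    (hw : ContMDiff I 𝓘(ℝ) ∞ w) (hw0 : ∀ x, w x ≠ 0) :
    IsLegendreTransform (pairing o h') (kineticEnergy o h w) (kineticEnergy o h' w⁻¹) := by
  have hmomentum {β : DiffForm I M k} (hβ : IsSmoothForm β) :=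
    isVariationalDeriv_kineticEnergy o h h' hw hβ
  have hmomentum_eq {β : DiffForm I M k} {α : DiffForm I M l} (hβ : IsSmoothForm β)
      (hα : IsVariationalDeriv (pairing o h') (kineticEnergy o h w) β α) :
      α = (-1 : ℝ) ^ (k * l) • weightedHodgeStar o h w β :=
    (hmomentum hβ).2.2 α hα.1 hα.2.1
  refine ⟨fun β hβ => ⟨_, hmomentum hβ⟩, fun α hα => ?_, fun β α hβ hα => ?_⟩
  · have hβ : IsSmoothForm (weightedHodgeStar o h' w⁻¹ α) :=
      hα.weightedHodgeStar h' (hw.inv₀ hw0)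
    refine ⟨weightedHodgeStar o h' w⁻¹ α, ⟨hβ, ?_⟩, fun β' hβ' => ?_⟩
    · simpa only [smul_weightedHodgeStar_weightedHodgeStar_inv o h h' hw0] using hmomentum hβ
    · rw [hmomentum_eq hβ'.1 hβ'.2, weightedHodgeStar_inv_smul_weightedHodgeStar o h h' hw0]
  · rw [hmomentum_eq hβ hα, kineticEnergy, kineticEnergy,
      weightedHodgeStar_inv_smul_weightedHodgeStar o h h' hw0, pairing_neg_one_pow_smul o h]
    ring

theorem hasDerivAt_kineticEnergy_inv [MeasurableSpace M] [BorelSpace M] (h : k + l = n)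
    {w σ : M → ℝ} (hw : Continuous w) (hσ : Continuous σ) (hw0 : ∀ x, w x ≠ 0)
    {β : DiffForm I M k} (hβ : IsSmoothForm β) :
    HasDerivAt (fun ε : ℝ => kineticEnergy o h (w + ε • σ)⁻¹ β)
      (∫ x, -(1 / (2 * w x ^ 2)) * formInner (β x) (β x) * σ x ∂riemannianMeasure I M) 0 := by
  have hline : Continuous fun p : ℝ × M => w p.2 + p.1 * σ p.2 := by fun_prop
  have hq := (hβ.contMDiff_formInner hβ).continuous
  have hs : ∀ᶠ ε in nhds 0, ∀ x, w x + ε * σ x ≠ 0 := by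
    simpa using isCompact_univ.eventually_forall_of_forall_eventually (x₀ := (0 : ℝ))
      (P := fun ε x => w x + ε * σ x ≠ 0) fun x _ =>
        hline.continuousAt.eventually_ne (by simpa using hw0 x)
  have hcont {ε : ℝ} (hε : ∀ x, w x + ε * σ x ≠ 0) : Continuous (w + ε • σ)⁻¹ :=
    (hw.add (hσ.const_smul ε)).inv₀ hε
  have hderiv (ε : ℝ) (hε : ∀ x, w x + ε * σ x ≠ 0) (x : M) :
      HasDerivAt (fun ε => 1 / 2 * ((w + ε • σ)⁻¹ x * formInner (β x) (β x)))
        (-(1 / (2 * (w x + ε * σ x) ^ 2)) * formInner (β x) (β x) * σ x) ε := by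
    have hline' : HasDerivAt (fun ε => w x + ε * σ x) (σ x) ε := by
      simpa using ((hasDerivAt_id ε).mul_const (σ x)).const_add (w x)
    convert! ((hline'.inv (hε x)).mul_const (formInner (β x) (β x))).const_mul (1 / 2) using 1
    field_simp
  have hint := hasDerivAt_integral_of_continuousOn (ν := riemannianMeasure I M) hs
    (fun ε hε => continuous_const.mul ((hcont hε).mul hq)) (F' := fun ε x =>
      -(1 / (2 * (w x + ε * σ x) ^ 2)) * formInner (β x) (β x) * σ x) ?_ hderiv
  · simp only [zero_mul, add_zero] at hint
    refine hint.congr_of_eventuallyEq (Filter.eventually_of_mem hs fun ε hε => ?_)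
    simp only [kineticEnergy, pairing_weightedHodgeStar o h (hcont hε) hβ hβ, ← integral_const_mul]
    rfl
  · refine ((continuousOn_const.div (continuous_const.mul (hline.pow 2)).continuousOn ?_).neg.mul
      (hq.comp continuous_snd).continuousOn).mul (hσ.comp continuous_snd).continuousOn
    exact fun p hp => mul_ne_zero two_ne_zero (pow_ne_zero 2 (hp.1 p.2))

theorem isVariationalDeriv_hamiltonian_massEffort (hn : 1 ≤ n) {α : DiffForm I M 1}
    (hα : IsSmoothForm α) {μ : DiffForm I M n} (hμ : IsSmoothForm μ)
    (hμ0 : ∀ x, density o μ x ≠ 0) :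
    IsVariationalDeriv (pairing o (Nat.zero_add n)) (fun μ' => hamiltonian hn o α μ') μ
      (massEffort o α μ) := by
  borelize M
  have hρ := hμ.contMDiff_density (o := o)
  have happly (x : M) : massEffort o α μ x Fin.elim0 =
      -(1 / (2 * density o μ x ^ 2)) * formInner (α x) (α x) := by
    rw [← curryLeft_sharp_self (α x) Fin.elim0]
    rfl
  have hsmooth : IsSmoothForm (massEffort o α μ) := by
    simp only [isSmoothForm_zero_iff, happly]
    exact ((contMDiff_const.div₀ (contMDiff_const.mul (hρ.pow 2))
      fun x => mul_ne_zero two_ne_zero (pow_ne_zero 2 (hμ0 x))).neg).mul (hα.contMDiff_formInner hα)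
  refine isVariationalDeriv_pairing o (Nat.zero_add n) hsmooth fun δ hδ => ?_
  simp only [hamiltonian_eq_kineticEnergy, density_add_smul, pairing_zero_left o hsmooth hδ, happly]
  exact hasDerivAt_kineticEnergy_inv o _ hρ.continuous (hδ.contMDiff_density (o := o)).continuous
    hμ0 hα

end KineticEnergy

end FluidKinetic

theorem theorem2 {n : ℕ} (hn : 1 ≤ n) {H : Type*} [TopologicalSpace H]
    (I : ModelWithCorners ℝ (EuclideanSpace ℝ (Fin n)) H)
    (M : Type*) [TopologicalSpace M] [ChartedSpace H M] [IsManifold I ∞ M]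
    [CompactSpace M] [T2Space M]
    [RiemannianBundle (fun x : M => TangentSpace I x)]
    [IsContMDiffRiemannianBundle I ∞ (EuclideanSpace ℝ (Fin n)) (fun x : M => TangentSpace I x)]
    (o : ManifoldOrientation I M)
    (μ : DiffForm I M n) (hμ : IsSmoothForm μ) (hμ0 : ∀ x, density o μ x ≠ 0) :
    -- `(-1)^(n-1) (*μ) *β` is the momentum conjugate to `β`
    (∀ β : DiffForm I M (n - 1), IsSmoothForm β →
      IsVariationalDeriv (fun α δβ => pairing o (Nat.add_sub_of_le hn) α δβ)
        (fun β' => lagrangian hn o β' μ) β (momentum hn o β μ)) ∧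
    -- `H_k(·, μ)` is the Legendre transform of `L_k(·, μ)`
    IsLegendreTransform (fun α β => pairing o (Nat.add_sub_of_le hn) α β)
      (fun β => lagrangian hn o β μ) (fun α => hamiltonian hn o α μ) ∧
    -- the variational derivatives of `H_k`
    ∀ α : DiffForm I M 1, IsSmoothForm α →
      IsVariationalDeriv (fun β δα => pairing o (Nat.add_sub_of_le hn) δα β)
        (fun α' => hamiltonian hn o α' μ) α (velocityForm hn o α μ) ∧
      IsVariationalDeriv (fun f δμ => pairing o (Nat.zero_add n) f δμ)
        (fun μ' => hamiltonian hn o α μ') μ (massEffort o α μ) := by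
  have hρ := hμ.contMDiff_density (o := o)
  simp only [lagrangian_eq_kineticEnergy, momentum_eq_smul_weightedHodgeStar]
  refine ⟨fun β hβ => isVariationalDeriv_kineticEnergy o _ _ hρ hβ, ?_, fun α hα => ⟨?_, ?_⟩⟩
  · simp only [hamiltonian_eq_kineticEnergy]
    exact isLegendreTransform_kineticEnergy o _ _ hρ hμ0
  · simp only [hamiltonian_eq_kineticEnergy]
    exact isVariationalDeriv_kineticEnergy_swap o _ (hρ.inv₀ hμ0) hα
  · exact isVariationalDeriv_hamiltonian_massEffort o hn hα hμ hμ0
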